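/- Let $\mathbb K$ be a field of characteristic different from $2$ and let $\omega$ be a feasible exponent for matrix multiplication over $\mathbb K$ (two $N\times N$ matrices can be multiplied with $O(N^\omega)$ arithmetic operations). Let $M$ be a finite set of monomials of degree at most $2$ in $\mathbb K[X_1,\dots,X_n]$ with $1\in M$, let $\langle M\rangle$ be its $\mathbb K$-linear span, and let $M^2$ be the set of products of two (not necessarily distinct) elements of $M$. Put $M^h=\{X_0^{2-\deg\mu}\mu : \mu\in M\}$, and let $G$ be the graph on the vertices $0,\dots,n$ that has an edge between $i\ne j$ if and only if $X_iX_j\in M^h$, and a loop at $i$ if and only if $X_i^2\in M^h$. Let * $\nu(M)$ be the maximal number of edges in a matching of the subgraph of $G$ induced on the vertices with a loop; * $\lambda(G)$ be the number of subgraphs of $G$ isomorphic to one of the following three graphs: a cycle on $4$ vertices without loops; a triangle with a loop at exactly one vertex; an edge with a loop at both ends; * $\mathrm{clique}_4(G)$ be the number of $4$-cliques of $G$. Let $m$ be an integer with $m\ge |M|-\frac{\sqrt{1+8\nu(M)}-1}{2}$. Then: 1. For all $f_1,\dots,f_m,h_1,\dots,h_m\in\langle M\rangle$, one has $\sum_{i=1}^m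 f_ih_i=1$ if and only if the $m|M|$ coefficients of $h_1,\dots,h_m$ solve the linear system with $|M^2|$ equations obtained by comparing, in $\sum_{i}\sum_{\mu\in M}\alpha_{\mu,i}\,\mu f_i=1$, the coefficients of the monomials of $M^2$. 2. There is an algorithm (an algebraic computation tree with constants in $\mathbb K$, given for each $n,m,M$, in which only the operations $+,-,\times,\div$ are counted) that takes the $m|M|$ coefficients of a system $(f_1,\dots,f_m)\in\langle M\rangle^m$ as input and, for a generic system, computes $h_1,\dots,h_m\in\langle M\rangle$ such that $\sum_{i=1}^m f_ih_i=1$, within $$O\left(m|M|\left(\binom{|M|+1}{2}-\lambda(G)+\mathrm{clique}_4(G)\right)^{\omega-1}\right)$$ operations, where the implied constant depends only on $\mathbb K$ and $\omega$. Here "generic" means: whenever a certain polynomial over $\mathbb K$ in the coefficients of the system, which does not vanish at all systems over $\mathbb K$, is nonzero; the coefficients of the system may lie in $\mathbb K$ or in an extension field. 3. The quantity $m|M|\left(\binom{|M|+1}{2}-\lambda(G)+\mathrm{clique}_4(G)\right)^{\omega-1}$ is bounded by a polynomial in $m|M|$ that depends only on $\mathbb K$ and $\omega$. -/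

import Mathlib

open scoped Pointwise

universe u

noncomputable section

namespace Fewnomial

/-! Graph of a support.  A monomial `X^μ` in `n` variables is represented by its exponent
vector `μ : Fin n →₀ ℕ`, and a support by a finite set of exponent vectors. -/

/-- The homogenized support `{X₀^(2 - deg μ) * μ : μ ∈ M}`, in the variables `X₀, …, Xₙ`. -/
def homogenizedSupport {n : ℕ} (M : Finset (Fin n →₀ ℕ)) : Set (Fin (n + 1) →₀ ℕ) :=
  {γ | ∃ μ ∈ M, γ = Finsupp.cons (2 - μ.degree) μ}

/-- The graph on `{0, …, n}` with an edge between `i ≠ j` iff `X_i X_j` is in the homogenized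
support. The loops are recorded separately in `loopVertices`. -/
def supportGraph {n : ℕ} (M : Finset (Fin n →₀ ℕ)) : SimpleGraph (Fin (n + 1)) where
  Adj i j := i ≠ j ∧ Finsupp.single i 1 + Finsupp.single j 1 ∈ homogenizedSupport M
  symm := ⟨fun i j h => ⟨h.1.symm, add_comm (Finsupp.single i 1) (Finsupp.single j 1) ▸ h.2⟩⟩
  loopless := ⟨fun _ h => h.1 rfl⟩

/-- The vertices carrying a loop: those `i` for which `X_i²` is in the homogenized support. -/
def loopVertices {n : ℕ} (M : Finset (Fin n →₀ ℕ)) : Set (Fin (n + 1)) :=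
  {i | Finsupp.single i 2 ∈ homogenizedSupport M}

/-- All edges of the support graph, a loop at `i` being the diagonal element `s(i, i)`. -/
def edgesAndLoops {n : ℕ} (M : Finset (Fin n →₀ ℕ)) : Set (Sym2 (Fin (n + 1))) :=
  (supportGraph M).edgeSet ∪ Sym2.diag '' loopVertices M

/-- The edge sets contained in `E` which are isomorphic to the pattern `H`. When `H` has no
isolated vertex, these are the subgraphs isomorphic to `H` of the graph with edge set `E`. -/
def copiesIn {V : Type} {k : ℕ} (H : Set (Sym2 (Fin k))) (E : Set (Sym2 V)) :
    Set (Set (Sym2 V)) :=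
  {S | S ⊆ E ∧ ∃ φ : Fin k → V, Function.Injective φ ∧ S = Sym2.map φ '' H}

/-- Relation of type 1, a cycle with four vertices and no loops. -/
def pattern₁ : Set (Sym2 (Fin 4)) := {s(0, 1), s(1, 2), s(2, 3), s(3, 0)}

/-- Relation of type 2, a triangle with a loop at one vertex. -/
def pattern₂ : Set (Sym2 (Fin 3)) := {s(0, 0), s(0, 1), s(0, 2), s(1, 2)}

/-- Relation of type 3, an edge with a loop at both ends. -/
def pattern₃ : Set (Sym2 (Fin 2)) := {s(0, 0), s(1, 1), s(0, 1)}

/-- `λ(G)`: the number of subgraphs isomorphic to one of the three patterns. -/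
def lambdaCount {n : ℕ} (M : Finset (Fin n →₀ ℕ)) : ℕ :=
  (copiesIn pattern₁ (edgesAndLoops M) ∪ copiesIn pattern₂ (edgesAndLoops M) ∪
    copiesIn pattern₃ (edgesAndLoops M)).ncard

/-- The number of `4`-cliques of the support graph. -/
def cliqueCount₄ {n : ℕ} (M : Finset (Fin n →₀ ℕ)) : ℕ :=
  ((supportGraph M).cliqueSet 4).ncard

/-- The maximal number of edges of a matching of a (finite) graph. -/
def matchingNumber {V : Type} (G : SimpleGraph V) : ℕ :=
  sSup {k | ∃ A : G.Subgraph, A.IsMatching ∧ A.edgeSet.ncard = k}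

/-- `ν(M)`: the matching number of the subgraph induced on the vertices with a loop. -/
def nu {n : ℕ} (M : Finset (Fin n →₀ ℕ)) : ℕ :=
  matchingNumber ((supportGraph M).induce (loopVertices M))

/-! Systems with support in `M`, and certificates.  A tuple of `m` polynomials in the linear span
of `M` is represented by its coefficients `c : Fin m × M → L`. -/

/-- The `i`-th polynomial of the tuple with coefficients `c`. -/
def poly {n m : ℕ} {M : Finset (Fin n →₀ ℕ)} {L : Type u} [Field L]
    (c : Fin m × M → L) (i : Fin m) : MvPolynomial (Fin n) L :=
  ∑ μ : M, MvPolynomial.monomial (μ : Fin n →₀ ℕ) (c (i, μ))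

/-- The tuple `h` certifies that the system `f` is inconsistent: `∑ f_i h_i = 1`. -/
def IsCertificate {n m : ℕ} {M : Finset (Fin n →₀ ℕ)} {L : Type u} [Field L]
    (f h : Fin m × M → L) : Prop :=
  ∑ i, poly f i * poly h i = 1

/-- The matrix with a row for each monomial `σ` of `M²` and a column for each product `μ f_i`,
`μ ∈ M`; it holds the coefficient of `σ` in `μ f_i`. -/
def macaulayMatrix {n m : ℕ} {M : Finset (Fin n →₀ ℕ)} {L : Type u} [Field L]
    (f : Fin m × M → L) : Matrix ↥(M + M) (Fin m × M) L :=
  fun σ x => MvPolynomial.coeff (σ : Fin n →₀ ℕ)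
    (MvPolynomial.monomial (x.2 : Fin n →₀ ℕ) 1 * poly f x.1)

/-- The coefficients, on the monomials of `M²`, of the constant polynomial `1`. -/
def oneVector {n : ℕ} (M : Finset (Fin n →₀ ℕ)) (L : Type u) [Field L] : ↥(M + M) → L :=
  fun σ => MvPolynomial.coeff (σ : Fin n →₀ ℕ) 1

/-! Arithmetic complexity model. -/

/-- The arithmetic operations of a field. -/
inductive ArithOp
  | add | sub | mul | div

/-- The result of an operation; a division by zero is not allowed. -/
def ArithOp.eval {L : Type u} [Field L] : ArithOp → L → L → Option L
  | .add, a, b => some (a + b)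
  | .sub, a, b => some (a - b)
  | .mul, a, b => some (a * b)
  | .div, a, b => open Classical in if b = 0 then none else some (a / b)

/-- Algebraic computation trees over `K`, acting on a memory with registers `R`: load a constant
of `K`, copy a register, apply an arithmetic operation to the registers `x`, `y` and store its
result in the register `d`, or branch according to whether a register is zero. -/
inductive Program (K : Type u) (R : Type) : Type u
  | halt : Program K R
  | const (d : R) (c : K) (next : Program K R) : Program K R
  | copy (d x : R) (next : Program K R) : Program K R
  | arith (o : ArithOp) (d x y : R) (next : Program K R) : Program K R
  | ifZero (x : R) (yes no : Program K R) : Program K R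

/-- The number of operations `+, -, ×, ÷` performed, in the worst case over all branches. -/
def Program.cost {K : Type u} {R : Type} : Program K R → ℕ
  | .halt => 0
  | .const _ _ next => next.cost
  | .copy _ _ next => next.cost
  | .arith _ _ _ _ next => next.cost + 1
  | .ifZero _ yes no => max yes.cost no.cost

/-- Execution on a memory with values in an extension field `L` of `K`. It returns the final
memory, or `none` if a division by zero was attempted. -/
def Program.run {K : Type u} {R : Type} {L : Type u} [DecidableEq R] [Field K] [Field L]
    [Algebra K L] : Program K R → (R → L) → Option (R → L)
  | .halt, mem => some mem
  | .const d c next, mem => next.run (Function.update mem d (algebraMap K L c))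
  | .copy d x next, mem => next.run (Function.update mem d (mem x))
  | .arith o d x y next, mem =>
      (o.eval (mem x) (mem y)).bind fun z => next.run (Function.update mem d z)
  | .ifZero x yes no, mem => open Classical in if mem x = 0 then yes.run mem else no.run mem

/-- On the input `a`, stored in the registers `Sum.inl i` (the other registers being
uninitialized, that is, of arbitrary content), the program terminates without dividing by zero
and leaves in the registers `out` a tuple with the property `Q`. -/
def Program.Returns {K : Type u} {ι o : Type} {L : Type u} [DecidableEq ι] [Field K] [Field L]
    [Algebra K L] (p : Program K (ι ⊕ ℕ)) (out : o → ι ⊕ ℕ) (a : ι → L) (Q : (o → L) → Prop) :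
    Prop :=
  ∀ mem : ι ⊕ ℕ → L, (∀ i, mem (Sum.inl i) = a i) →
    ∃ mem', p.run mem = some mem' ∧ Q fun k => mem' (out k)

/-- `ω` is a feasible exponent for matrix multiplication over `K`: two `N × N` matrices can be
multiplied with `O(N^ω)` arithmetic operations. As usual in algebraic complexity, the programs
compute the product as a formal expression in the entries, that is, they have constants in `K`
and are correct over all extension fields of `K`. -/
def IsFeasibleExponent (K : Type u) [Field K] (ω : ℝ) : Prop :=
  ∃ c : ℝ, ∀ N : ℕ, ∃ (p : Program K ((Fin N × Fin N ⊕ Fin N × Fin N) ⊕ ℕ))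
    (out : Fin N × Fin N → (Fin N × Fin N ⊕ Fin N × Fin N) ⊕ ℕ),
    (p.cost : ℝ) ≤ c * (N : ℝ) ^ ω ∧
    ∀ (L : Type u) [Field L] [Algebra K L] (A B : Matrix (Fin N) (Fin N) L),
      p.Returns out (Sum.elim (fun x => A x.1 x.2) (fun x => B x.1 x.2))
        fun r => ∀ i j, r (i, j) = (A * B) i j

/-- The property `Q` holds for a generic point of the affine space with coordinates `ι` over `K`:
it holds wherever a certain polynomial `P` over `K` does not vanish, at points with coordinates
in `K` or in an extension field, and `P` does not vanish at all points over `K`. (If `K` is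
infinite the latter just means `P ≠ 0`, so that the non-vanishing locus is open and dense.) -/
def HoldsGenerically (K : Type u) [Field K] (ι : Type)
    (Q : ∀ (L : Type u) [Field L] [Algebra K L], (ι → L) → Prop) : Prop :=
  ∃ P : MvPolynomial ι K, (∃ a : ι → K, MvPolynomial.eval a P ≠ 0) ∧
    ∀ (L : Type u) [Field L] [Algebra K L] (a : ι → L), MvPolynomial.aeval a P ≠ 0 → Q L a

/-- The complexity bound `m |M| (C(|M| + 1, 2) - λ(G) + clique₄(G))^(ω - 1)`. -/
def complexityBound {n : ℕ} (m : ℕ) (M : Finset (Fin n →₀ ℕ)) (ω : ℝ) : ℝ :=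
  (m : ℝ) * (M.card : ℝ) *
    (((M.card + 1).choose 2 : ℝ) - (lambdaCount M : ℝ) + (cliqueCount₄ M : ℝ)) ^ (ω - 1)

end Fewnomial

end

open Fewnomial

/-!
The products of `f₁, …, f_m` with `⟨M⟩` lie in `⟨M²⟩`, so a certificate is a solution of the
linear system given by the Macaulay matrix of `f`, which has a row for each monomial of `M²`. The
argument has three ingredients.

*The number of rows.* Over the homogenized support, a monomial of `M²` is a product of four
variables, and its factorizations into two monomials of `M` are pairs of edges or loops of `G`.
There are one, two or three of them (`eq_of_pairSum_eq`), and `1 = r - r.choose 2 + r.choose 3`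
for each of these numbers `r`. Pairs of factorizations of the same monomial are closed walks of
length four with distinct opposite vertices, that is, relations of the three types
(`copies_eq_walks`); triples are `4`-cliques. Hence `|M²| = C(|M| + 1, 2) - λ(G) + clique₄(G)`
(`card_add_self_add_lambdaCount`).

*Full row rank.* Put `k = |M| - m`, so that `C(k + 1, 2) ≤ ν(M)`. It suffices to find a subspace
of `⟨M⟩` of codimension `k` whose products with `⟨M⟩` span `⟨M²⟩`. Each edge `{i, j}` of a
matching between vertices with loops gives a relation `(X_i²) (X_j²) = (X_i X_j)²`, and these
relations involve disjoint sets of monomials. Choose `k` of the monomials as normal forms, and let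
the subspace be generated by the differences of the other monomials and their normal forms, a
normal form being allowed to be zero. Modulo the products, `⟨M²⟩` is then spanned by the
`C(k + 1, 2)` products of two normal forms, and one matching edge is enough to reduce each of them
to zero (`exists_reduction`, `Reduction.exists_surjective_mulVec`). This produces a system over `K`
itself, however small `K` is.

*Solving the system.* Some `|M²|` columns form a matrix that is invertible at this particular
system `f₀`. Multiplied by the inverse that it has at `f₀`, the matrix becomes the identity at
`f₀`, and recursive block inversion meets only invertible pivots at the identity. The product of
the pivots, cleared of denominators, is the polynomial that describes genericity (`pivotProd`).
Block inversion costs `O(N ^ ω)` since `ω ≥ 2` (`exists_computes_inverse`), and `ω ≥ 2` holds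
because a product of two matrices can have `N ^ 2` entries that each require an operation of their
own (`two_le_of_isFeasibleExponent`). Finally `|M²| ^ ω ≤ m |M| |M²| ^ (ω - 1)` by the rank
statement.

Programs are handled through `Computes`, which relates sets of elements of a product `∀ θ, L θ` of
extension fields of `K`: a quantity is a function of the instance `θ` on which the program runs.
-/

namespace Fewnomial

/-! ### Composing programs -/

section Programs

variable {K : Type u} {R R' : Type}

/-- Run `p`, and then `q` from whichever leaf of the computation tree `p` has reached. -/
def Program.seq : Program K R → Program K R → Program K R
  | .halt, q => q
  | .const d c next, q => .const d c (next.seq q)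
  | .copy d x next, q => .copy d x (next.seq q)
  | .arith o d x y next, q => .arith o d x y (next.seq q)
  | .ifZero x yes no, q => .ifZero x (yes.seq q) (no.seq q)

/-- The program with its registers renamed along `g`. -/
def Program.rename (g : R → R') : Program K R → Program K R'
  | .halt => .halt
  | .const d c next => .const (g d) c (next.rename g)
  | .copy d x next => .copy (g d) (g x) (next.rename g)
  | .arith o d x y next => .arith o (g d) (g x) (g y) (next.rename g)
  | .ifZero x yes no => .ifZero (g x) (yes.rename g) (no.rename g)

/-- Copy the registers `src k` to the registers `dst k`, for the indices `k` in a list. -/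
def Program.copyAll {κ : Type} (dst src : κ → R) : List κ → Program K R
  | [] => .halt
  | k :: l => .copy (dst k) (src k) (Program.copyAll dst src l)

theorem Program.cost_seq (p q : Program K R) : (p.seq q).cost ≤ p.cost + q.cost := by
  induction p with
  | halt => simp [Program.seq, Program.cost]
  | const d c next ih => simpa [Program.seq, Program.cost] using ih
  | copy d x next ih => simpa [Program.seq, Program.cost] using ih
  | arith o d x y next ih => simp only [Program.seq, Program.cost]; omega
  | ifZero x yes no ih₁ ih₂ => simp only [Program.seq, Program.cost]; omega

theorem Program.cost_rename (g : R → R') (p : Program K R) : (p.rename g).cost = p.cost := by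
  induction p with
  | halt => rfl
  | const d c next ih => simpa [Program.rename, Program.cost] using ih
  | copy d x next ih => simpa [Program.rename, Program.cost] using ih
  | arith o d x y next ih => simpa [Program.rename, Program.cost] using ih
  | ifZero x yes no ih₁ ih₂ => simp only [Program.rename, Program.cost, ih₁, ih₂]

theorem Program.cost_copyAll {κ : Type} (dst src : κ → R) (l : List κ) :
    (Program.copyAll (K := K) dst src l).cost = 0 := by
  induction l with
  | nil => rfl
  | cons k l ih => simpa [Program.copyAll, Program.cost] using ih

variable [DecidableEq R] [DecidableEq R'] [Field K] {L : Type u} [Field L] [Algebra K L]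

theorem Program.run_seq (p q : Program K R) (mem : R → L) :
    (p.seq q).run mem = (p.run mem).bind q.run := by
  induction p generalizing mem with
  | halt => rfl
  | const d c next ih => simp [Program.seq, Program.run, ih]
  | copy d x next ih => simp [Program.seq, Program.run, ih]
  | arith o d x y next ih => simp [Program.seq, Program.run, ih, Option.bind_assoc]
  | ifZero x yes no ih₁ ih₂ =>
    simp only [Program.seq, Program.run, ih₁, ih₂]
    split_ifs <;> rfl

/-- Renaming the registers along an injective map is harmless: the program works on the renamed
registers as before and leaves all the others alone. -/
theorem Program.run_rename {g : R → R'} (hg : Function.Injective g) (p : Program K R)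
    (mem : R' → L) {res : R → L} (h : p.run (mem ∘ g) = some res) :
    ∃ mem', (p.rename g).run mem = some mem' ∧ mem' ∘ g = res ∧
      ∀ r, r ∉ Set.range g → mem' r = mem r := by
  have upd : ∀ (mem : R' → L) (d : R) (z : L),
      Function.update mem (g d) z ∘ g = Function.update (mem ∘ g) d z :=
    fun mem d z => Function.update_comp_eq_of_injective _ hg _ _
  have frame : ∀ (mem : R' → L) (d : R) (z : L) (r : R'), r ∉ Set.range g →
      Function.update mem (g d) z r = mem r := fun mem d z r hr =>
    Function.update_of_ne (fun e => hr ⟨d, e.symm⟩) _ _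
  induction p generalizing mem with
  | halt => exact ⟨mem, rfl, by simpa [Program.run] using h, fun _ _ => rfl⟩
  | const d c next ih =>
    simp only [Program.run, ← upd] at h
    obtain ⟨m', h₁, h₂, h₃⟩ := ih _ h
    exact ⟨m', h₁, h₂, fun r hr => (h₃ r hr).trans (frame _ _ _ r hr)⟩
  | copy d x next ih =>
    simp only [Program.run, ← upd] at h
    obtain ⟨m', h₁, h₂, h₃⟩ := ih _ h
    exact ⟨m', h₁, h₂, fun r hr => (h₃ r hr).trans (frame _ _ _ r hr)⟩
  | arith o d x y next ih =>
    simp only [Program.run, ← upd] at h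
    obtain ⟨z, hz, h⟩ := Option.bind_eq_some_iff.1 h
    obtain ⟨m', h₁, h₂, h₃⟩ := ih _ h
    refine ⟨m', ?_, h₂, fun r hr => (h₃ r hr).trans (frame _ _ _ r hr)⟩
    simp only [Function.comp_apply] at hz
    simp [Program.rename, Program.run, hz, h₁]
  | ifZero x yes no ih₁ ih₂ =>
    simp only [Program.run, Program.rename, Function.comp_apply] at h ⊢
    split_ifs at h ⊢
    · exact ih₁ _ h
    · exact ih₂ _ h

theorem Program.run_copyAll {κ : Type} {dst src : κ → R} (hd : Function.Injective dst)
    (hne : ∀ k k', src k ≠ dst k') (l : List κ) (mem : R → L) :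
    ∃ mem', (Program.copyAll (K := K) dst src l).run mem = some mem' ∧
      (∀ k ∈ l, mem' (dst k) = mem (src k)) ∧ ∀ r, (∀ k ∈ l, r ≠ dst k) → mem' r = mem r := by
  induction l generalizing mem with
  | nil => exact ⟨mem, rfl, by simp, fun _ _ => rfl⟩
  | cons k l ih =>
    obtain ⟨m', h₁, h₂, h₃⟩ := ih (Function.update mem (dst k) (mem (src k)))
    refine ⟨m', h₁, fun k' hk' => ?_, fun r hr => ?_⟩
    · by_cases hl : k' ∈ l
      · rw [h₂ k' hl, Function.update_of_ne (hne _ _)]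
      · obtain rfl : k' = k := by simpa [hl] using hk'
        rw [h₃ _ fun j hj e => hl (by rwa [hd e]), Function.update_self]
    · rw [h₃ r fun j hj => hr j (List.mem_cons_of_mem _ hj),
        Function.update_of_ne (hr k List.mem_cons_self)]

/-- A program of cost `c` can create at most `c` values besides its initial ones and the
constants. -/
theorem Program.exists_finset_of_run (p : Program K R) (S : Set L) (mem mem' : R → L)
    (hS : ∀ r, mem r ∈ S ∪ Set.range (algebraMap K L)) (h : p.run mem = some mem') :
    ∃ F : Finset L, F.card ≤ p.cost ∧ ∀ r, mem' r ∈ S ∪ Set.range (algebraMap K L) ∪ F := by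
  classical
  induction p generalizing S mem with
  | halt =>
    obtain rfl : mem = mem' := by simpa [Program.run] using h
    exact ⟨∅, by simp, fun r => Or.inl (hS r)⟩
  | const d c next ih =>
    refine ih S _ (fun r => ?_) h
    by_cases hr : r = d
    · subst hr; simp
    · rw [Function.update_of_ne hr]; exact hS r
  | copy d x next ih =>
    refine ih S _ (fun r => ?_) h
    by_cases hr : r = d
    · subst hr; simpa using hS x
    · rw [Function.update_of_ne hr]; exact hS r
  | arith o d x y next ih =>
    obtain ⟨z, -, h⟩ := Option.bind_eq_some_iff.1 h
    obtain ⟨F, hF, hm⟩ := ih (insert z S) (Function.update mem d z) (fun r => by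
      by_cases hr : r = d
      · subst hr; simp
      · rw [Function.update_of_ne hr]
        exact (hS r).imp_left (Set.mem_insert_of_mem _)) h
    refine ⟨insert z F, (Finset.card_insert_le _ _).trans (Nat.succ_le_succ hF), fun r => ?_⟩
    have := hm r
    simp only [Set.mem_union, Set.mem_insert_iff, Finset.coe_insert] at this ⊢
    tauto
  | ifZero x yes no ih₁ ih₂ =>
    simp only [Program.run] at h
    split_ifs at h
    · obtain ⟨F, hF, hm⟩ := ih₁ S mem hS h
      exact ⟨F, hF.trans (le_max_left _ _), hm⟩
    · obtain ⟨F, hF, hm⟩ := ih₂ S mem hS h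
      exact ⟨F, hF.trans (le_max_right _ _), hm⟩

end Programs

/-! ### The exponent of matrix multiplication is at least two -/

/-- The product of the matrix with first column `(t ^ ((N + 1) * (i + 1)))ᵢ` and of the matrix with
first row `(t ^ (j + 1))ⱼ`, with zeros elsewhere, has `N ^ 2` distinct entries, none of which is
constant or an entry of a factor; each of them costs an operation. -/
theorem sq_le_cost_of_returns_mul {K : Type u} [Field K] {N : ℕ}
    {p : Program K ((Fin N × Fin N ⊕ Fin N × Fin N) ⊕ ℕ)}
    {out : Fin N × Fin N → (Fin N × Fin N ⊕ Fin N × Fin N) ⊕ ℕ}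
    (hp : ∀ (L : Type u) [Field L] [Algebra K L] (A B : Matrix (Fin N) (Fin N) L),
      p.Returns out (Sum.elim (fun x => A x.1 x.2) (fun x => B x.1 x.2))
        fun r => ∀ i j, r (i, j) = (A * B) i j) : N ^ 2 ≤ p.cost := by
  classical
  rcases N with - | N
  · simp
  set t : ℕ → RatFunc K := fun a => algebraMap (Polynomial K) (RatFunc K) (Polynomial.X ^ a)
    with ht
  have t_add : ∀ a b, t (a + b) = t a * t b := fun a b => by simp only [ht, pow_add, map_mul]
  have t_inj : ∀ a b, t a = t b → a = b := fun a b h => by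
    have := congrArg Polynomial.natDegree (IsFractionRing.injective (Polynomial K) (RatFunc K) h)
    simpa using this
  have t_const : ∀ a (c : K), t a = algebraMap K (RatFunc K) c → a = 0 := fun a c h => by
    rw [IsScalarTower.algebraMap_apply K (Polynomial K) (RatFunc K)] at h
    have := congrArg Polynomial.natDegree (IsFractionRing.injective (Polynomial K) (RatFunc K) h)
    simpa using this
  set A : Matrix (Fin (N + 1)) (Fin (N + 1)) (RatFunc K) :=
    fun i k => if k = 0 then t ((N + 2) * (i + 1)) else 0 with hA
  set B : Matrix (Fin (N + 1)) (Fin (N + 1)) (RatFunc K) :=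
    fun k j => if k = 0 then t (j + 1) else 0 with hB
  have hAB : ∀ i j, (A * B) i j = t ((N + 2) * (i + 1) + (j + 1)) := fun i j => by
    rw [Matrix.mul_apply, t_add]
    simp [hA, hB]
  set inp : (Fin (N+1) × Fin (N+1) ⊕ Fin (N+1) × Fin (N+1)) → RatFunc K :=
    Sum.elim (fun x => A x.1 x.2) (fun x => B x.1 x.2) with hinp
  obtain ⟨mem', hrun, hres⟩ := hp (RatFunc K) A B (Sum.elim inp fun _ => 0) fun i => rfl
  obtain ⟨F, hF, hmem⟩ := p.exists_finset_of_run (Set.range inp) _ mem' (fun r => by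
    rcases r with r | r
    · exact Or.inl ⟨r, rfl⟩
    · exact Or.inr ⟨0, by simp⟩) hrun
  refine le_trans ?_ hF
  have key : ∀ x : Fin (N + 1) × Fin (N + 1), (A * B) x.1 x.2 ∈ F := by
    rintro ⟨i, j⟩
    have hi := i.2
    have hj := j.2
    have h := hmem (out (i, j))
    rw [show mem' (out (i, j)) = (A * B) i j from hres i j] at h
    have h0 : ∀ a, t (a + 1) ≠ 0 := fun a e => by
      have := t_const (a + 1) 0 (by rw [e, map_zero])
      omega
    rcases h with (⟨r, hr⟩ | ⟨c, hc⟩) | h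
    · exfalso
      rw [hAB] at hr
      rcases r with ⟨i', k⟩ | ⟨k, j'⟩
      · simp only [hinp, Sum.elim_inl, hA] at hr
        split_ifs at hr
        · have e := t_inj _ _ hr
          -- a multiple of `N + 2` cannot exceed another one by `j + 1`
          have e' := congrArg (· % (N + 2)) e
          simp only [Nat.mul_mod_right, Nat.mul_add_mod] at e'
          rw [Nat.mod_eq_of_lt (by omega)] at e'
          omega
        · exact h0 _ hr.symm
      · simp only [hinp, Sum.elim_inr, hB] at hr
        split_ifs at hr
        · have e := t_inj _ _ hr
          have := j'.2
          nlinarith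
        · exact h0 _ hr.symm
    · exfalso
      rw [hAB] at hc
      have := t_const _ c hc.symm
      omega
    · exact h
  calc (N + 1) ^ 2 = (Finset.univ : Finset (Fin (N + 1) × Fin (N + 1))).card := by simp [sq]
    _ ≤ F.card := by
      refine Finset.card_le_card_of_injOn (fun x => (A * B) x.1 x.2) (fun x _ => key x) ?_
      rintro ⟨i, j⟩ - ⟨i', j'⟩ - h
      simp only [hAB] at h
      have e := t_inj _ _ h
      have hj := j.2
      have hj' := j'.2
      have e' := congrArg (· % (N + 2)) e
      simp only [Nat.mul_add_mod] at e'
      rw [Nat.mod_eq_of_lt (by omega), Nat.mod_eq_of_lt (by omega)] at e'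
      have e'' : (N + 2) * ((i : ℕ) + 1) = (N + 2) * (i' + 1) := by omega
      have := Nat.eq_of_mul_eq_mul_left (by omega) e''
      ext <;> simp <;> omega

theorem two_le_of_isFeasibleExponent {K : Type u} [Field K] {ω : ℝ}
    (hω : IsFeasibleExponent K ω) : 2 ≤ ω := by
  obtain ⟨c, hc⟩ := hω
  by_contra! hlt
  -- `N ^ (2 - ω)` would be bounded
  have hbd : ∀ N : ℕ, 0 < N → (N : ℝ) ^ (2 - ω) ≤ c := fun N hN => by
    obtain ⟨p, out, hcost, hp⟩ := hc N
    have h1 : ((N : ℝ)) ^ (2 : ℝ) ≤ c * (N : ℝ) ^ ω := by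
      refine le_trans ?_ hcost
      rw [Real.rpow_two]
      exact_mod_cast sq_le_cost_of_returns_mul hp
    have hN' : (0 : ℝ) < N := by exact_mod_cast hN
    rw [Real.rpow_sub hN']
    exact (div_le_iff₀ (Real.rpow_pos_of_pos hN' _)).2 h1
  have ht := (tendsto_rpow_atTop (show 0 < 2 - ω by linarith)).comp
    (tendsto_natCast_atTop_atTop (R := ℝ))
  obtain ⟨N, hN, hN'⟩ := ((ht.eventually_gt_atTop c).and
    (Filter.eventually_gt_atTop 0)).exists
  exact absurd (hbd N hN') (not_le.2 hN)

/-! ### A calculus of derivations -/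

section Derivations

universe v

variable {K : Type u} [Field K] {Θ : Type v} {L : Θ → Type u} [∀ θ, Field (L θ)]
  [∀ θ, Algebra K (L θ)]

/-- A single program over `K` computes, at every instance `θ`, the values of the quantities `b`
from those of the quantities `a`, in at most `c` operations. A quantity is an element of the ring
`∀ θ, L θ`; this turns correctness of a program over all extension fields into identities in one
commutative ring. -/
def Derives (K : Type u) [Field K] {Θ : Type v} {L : Θ → Type u} [∀ θ, Field (L θ)]
    [∀ θ, Algebra K (L θ)] {ι κ : Type} [DecidableEq ι] (c : ℕ) (a : ι → ∀ θ, L θ)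
    (b : κ → ∀ θ, L θ) : Prop :=
  ∃ (p : Program K (ι ⊕ ℕ)) (out : κ → ι ⊕ ℕ), p.cost ≤ c ∧
    ∀ θ, p.Returns out (fun i => a i θ) fun r => ∀ k, r k = b k θ

section Families

variable {ι κ τ : Type} [DecidableEq ι] {c c₁ c₂ : ℕ}
  {a : ι → ∀ θ, L θ} {b : κ → ∀ θ, L θ} {d : τ → ∀ θ, L θ}

theorem Derives.mono (h : Derives K c₁ a b) (hc : c₁ ≤ c₂) : Derives K c₂ a b :=
  let ⟨p, out, hp, hr⟩ := h
  ⟨p, out, hp.trans hc, hr⟩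

theorem Derives.cast_target {b' : κ → ∀ θ, L θ} (h : Derives K c a b) (e : b = b') :
    Derives K c a b' :=
  e ▸ h

theorem Derives.reindex (a : ι → ∀ θ, L θ) (g : κ → ι) : Derives K 0 a (a ∘ g) :=
  ⟨.halt, fun k => Sum.inl (g k), le_rfl, fun _ mem hm =>
    ⟨mem, rfl, fun k => hm (g k)⟩⟩

theorem Derives.trans [DecidableEq κ] [Finite κ] (h₁ : Derives K c₁ a b) (h₂ : Derives K c₂ b d) :
    Derives K (c₁ + c₂) a d := by
  obtain ⟨p, out₁, hp, hr₁⟩ := h₁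
  obtain ⟨q, out₂, hq, hr₂⟩ := h₂
  obtain ⟨n, ⟨e⟩⟩ := Finite.exists_equiv_fin κ
  obtain ⟨enc, henc⟩ := exists_injective_nat (κ ⊕ ℕ)
  -- `p` works on the even scratch registers, `q` on the odd ones
  let g₁ : ι ⊕ ℕ → ι ⊕ ℕ := Sum.map id (2 * ·)
  let g₂ : κ ⊕ ℕ → ι ⊕ ℕ := fun r => Sum.inr (2 * enc r + 1)
  have hg₁ : Function.Injective g₁ :=
    Function.injective_id.sumMap (fun x y h => by simpa using h)
  have hg₂ : Function.Injective g₂ := fun x y h => henc (by simpa [g₂] using h)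
  have hne : ∀ r s, g₁ r ≠ g₂ s := by
    rintro (r | r) s h
    · simp [g₁, g₂] at h
    · simp only [g₁, g₂, Sum.map_inr, Sum.inr.injEq] at h
      omega
  let l : List κ := (List.finRange n).map e.symm
  have hl : ∀ k, k ∈ l := fun k => List.mem_map.2 ⟨e k, List.mem_finRange _, by simp⟩
  let mid : Program K (ι ⊕ ℕ) :=
    Program.copyAll (fun k => g₂ (Sum.inl k)) (fun k => g₁ (out₁ k)) l
  refine ⟨(p.rename g₁).seq (mid.seq (q.rename g₂)), g₂ ∘ out₂, ?_, fun θ mem hm => ?_⟩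
  · have h₁ := Program.cost_seq (p.rename g₁) (mid.seq (q.rename g₂))
    have h₂ := Program.cost_seq mid (q.rename g₂)
    rw [Program.cost_rename] at h₁ h₂
    have h₃ : mid.cost = 0 := Program.cost_copyAll _ _ _
    omega
  · obtain ⟨m₁, hm₁, hb⟩ := hr₁ θ (mem ∘ g₁) fun i => by simpa [g₁] using hm i
    obtain ⟨m₂, hm₂, hm₂', -⟩ := p.run_rename hg₁ mem hm₁
    obtain ⟨m₃, hm₃, hm₃', -⟩ := Program.run_copyAll (K := K) (R := ι ⊕ ℕ)
      (dst := fun k => g₂ (Sum.inl k)) (src := fun k => g₁ (out₁ k))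
      (fun x y h => Sum.inl_injective (hg₂ h)) (fun k k' => hne _ _) l m₂
    obtain ⟨m₄, hm₄, hd⟩ := hr₂ θ (m₃ ∘ g₂) fun k => by
      refine Eq.trans ?_ (hb k)
      rw [← hm₂']
      exact hm₃' k (hl k)
    obtain ⟨m₅, hm₅, hm₅', -⟩ := q.run_rename hg₂ m₃ hm₄
    refine ⟨m₅, ?_, fun k => ?_⟩
    · rw [Program.run_seq, hm₂, Option.bind_some, Program.run_seq, hm₃, Option.bind_some, hm₅]
    · rw [← hd k, ← hm₅']
      rfl

theorem Derives.frame [DecidableEq τ] (h : Derives K c a b) (d : τ → ∀ θ, L θ) :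
    Derives K c (Sum.elim a d) (Sum.elim b d) := by
  obtain ⟨p, out, hp, hr⟩ := h
  let g : ι ⊕ ℕ → (ι ⊕ τ) ⊕ ℕ := Sum.map Sum.inl id
  have hg : Function.Injective g := Sum.inl_injective.sumMap Function.injective_id
  refine ⟨p.rename g, Sum.elim (g ∘ out) (Sum.inl ∘ Sum.inr),
    (Program.cost_rename g p).trans_le hp, fun θ mem hm => ?_⟩
  obtain ⟨m₁, hm₁, hb⟩ := hr θ (mem ∘ g) fun i => hm (Sum.inl i)
  obtain ⟨m₂, hm₂, hm₂', hm₂''⟩ := p.run_rename hg mem hm₁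
  refine ⟨m₂, hm₂, ?_⟩
  rintro (k | k)
  · rw [Sum.elim_inl, ← hb k, ← hm₂']
    rfl
  · refine (hm₂'' _ ?_).trans (hm (Sum.inr k))
    rintro ⟨r | r, hr⟩ <;> simp [g] at hr

theorem Derives.pair [Finite ι] [Finite κ] [Finite τ] (h₁ : Derives K c₁ a b)
    (h₂ : Derives K c₂ a d) : Derives K (c₁ + c₂) a (Sum.elim b d) := by
  classical
  have e₁ : Sum.elim a a = a ∘ Sum.elim id id := by ext (i | i) <;> rfl
  have e₂ : Sum.elim a b = Sum.elim b a ∘ Sum.swap := by ext (i | i) <;> rfl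
  have e₃ : Sum.elim b d = Sum.elim d b ∘ Sum.swap := by ext (i | i) <;> rfl
  have h₁' : Derives K c₁ a (Sum.elim b a) :=
    ((e₁ ▸ Derives.reindex (K := K) a (Sum.elim id id)).trans (h₁.frame a)).mono (by omega)
  have h₂' : Derives K c₂ (Sum.elim b a) (Sum.elim d b) :=
    ((e₂ ▸ Derives.reindex (K := K) (Sum.elim b a) Sum.swap).trans (h₂.frame b)).mono (by omega)
  exact ((h₁'.trans h₂').trans
    (e₃ ▸ Derives.reindex (K := K) (Sum.elim d b) Sum.swap)).mono (by omega)

theorem Derives.family [Finite ι] [Fintype κ] {c : κ → ℕ}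
    (h : ∀ k, Derives K (c k) a fun _ : Unit => b k) : Derives K (∑ k, c k) a b := by
  classical
  have key : ∀ s : Finset κ, Derives K (∑ k ∈ s, c k) a fun k : s => b k := fun s => by
    induction s using Finset.induction_on with
    | empty => exact ⟨.halt, fun k => absurd k.2 (Finset.notMem_empty _), Nat.zero_le _,
        fun θ mem _ => ⟨mem, rfl, fun k => absurd k.2 (Finset.notMem_empty _)⟩⟩
    | insert k s hk ih =>
      rw [Finset.sum_insert hk]
      refine (((h k).pair ih).trans (Derives.reindex _ fun j : ↥(insert k s) =>
        if hj : (j : κ) ∈ s then Sum.inr ⟨j, hj⟩ else Sum.inl ())).cast_target ?_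
      funext j
      by_cases hj : (j : κ) ∈ s
      · simp [hj]
      · have e := (Finset.mem_insert.1 j.2).resolve_right hj
        simp [e, hk]
  exact ((key Finset.univ).trans (Derives.reindex _ fun k => ⟨k, Finset.mem_univ k⟩))

end Families

/-- Within `c` operations, any finite family of elements of `T` can be computed from any finite
family that comprises `S`. -/
def Computes (K : Type u) [Field K] {Θ : Type v} {L : Θ → Type u} [∀ θ, Field (L θ)]
    [∀ θ, Algebra K (L θ)] (c : ℕ) (S T : Set (∀ θ, L θ)) : Prop :=
  ∀ ⦃ι κ : Type⦄ [Finite ι] [Finite κ] [DecidableEq ι] (a : ι → ∀ θ, L θ) (b : κ → ∀ θ, L θ),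
    S ⊆ Set.range a → Set.range b ⊆ T → Derives K c a b

variable {c c₁ c₂ : ℕ} {S T U : Set (∀ θ, L θ)}

theorem Computes.mono (h : Computes K c₁ S T) (hc : c₁ ≤ c₂) : Computes K c₂ S T :=
  fun _ _ _ _ _ a b ha hb => (h a b ha hb).mono hc

theorem Computes.of_subset (h : T ⊆ S) : Computes K 0 S T := fun _ _ _ _ _ a b ha hb => by
  choose g hg using fun k => ha (h (hb ⟨k, rfl⟩))
  obtain rfl : a ∘ g = b := funext hg
  exact Derives.reindex a g

/-- Results already obtained remain available. -/
theorem Computes.andThen (hT : T.Finite) (h₁ : Computes K c₁ S T)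
    (h₂ : Computes K c₂ (S ∪ T) U) : Computes K (c₁ + c₂) S U := fun ι κ _ _ _ a b ha hb => by
  classical
  obtain ⟨n, t, ht⟩ := hT.fin_param
  have d₁ : Derives K c₁ a (Sum.elim a t) := by
    simpa using (Derives.reindex (K := K) a id).pair (h₁ a t ha ht.2.le)
  refine d₁.trans (h₂ _ b ?_ hb)
  rw [Set.Sum.elim_range, ht.2]
  exact Set.union_subset_union_left _ ha

theorem Computes.range {κ : Type} [Fintype κ] {c : κ → ℕ} {b : κ → ∀ θ, L θ}
    (h : ∀ k, Computes K (c k) S {b k}) : Computes K (∑ k, c k) S (Set.range b) :=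
  fun _ _ _ _ _ a d ha hd => by
    classical
    choose g hg using fun k => hd ⟨k, rfl⟩
    obtain rfl : b ∘ g = d := funext hg
    exact (Derives.family fun k => h k a (fun _ : Unit => b k) ha
      (by rw [Set.range_const])).trans (Derives.reindex b g)

/-- Loading constants is free. -/
theorem Computes.of_subset_union_constants
    (h : T ⊆ S ∪ Set.range (algebraMap K (∀ θ, L θ))) : Computes K 0 S T :=
  fun ι κ _ _ _ a b ha hb => by
    have := Fintype.ofFinite κ
    refine (Derives.family (c := fun _ => 0) fun k => ?_).mono (by simp)
    rcases h (hb ⟨k, rfl⟩) with hk | ⟨x, hx⟩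
    · obtain ⟨i, hi⟩ := ha hk
      exact (Derives.reindex a fun _ : Unit => i).cast_target (funext fun _ => hi)
    · refine ⟨.const (Sum.inr 0) x .halt, fun _ => Sum.inr 0, le_rfl, fun θ mem _ =>
        ⟨_, rfl, fun _ => ?_⟩⟩
      simp [← hx]

theorem Computes.arith (o : ArithOp) {x y z : ∀ θ, L θ} (hx : x ∈ S) (hy : y ∈ S)
    (h : ∀ θ, o.eval (x θ) (y θ) = some (z θ)) : Computes K 1 S {z} := fun ι κ _ _ _ a b ha hb => by
  obtain ⟨i, rfl⟩ := ha hx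
  obtain ⟨j, rfl⟩ := ha hy
  refine ⟨.arith o (Sum.inr 0) (Sum.inl i) (Sum.inl j) .halt, fun _ => Sum.inr 0, le_rfl,
    fun θ mem hm => ⟨Function.update mem (Sum.inr 0) (z θ), ?_, fun k => ?_⟩⟩
  · simp [Program.run, hm, h]
  · simpa using congrFun (hb ⟨k, rfl⟩ : b k = z).symm θ

theorem Computes.add {x y : ∀ θ, L θ} (hx : x ∈ S) (hy : y ∈ S) : Computes K 1 S {x + y} :=
  Computes.arith .add hx hy fun _ => rfl

theorem Computes.sub {x y : ∀ θ, L θ} (hx : x ∈ S) (hy : y ∈ S) : Computes K 1 S {x - y} :=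
  Computes.arith .sub hx hy fun _ => rfl

theorem Computes.div {x y z : ∀ θ, L θ} (hx : x ∈ S) (hy : y ∈ S) (h : y * z = x) (hu : IsUnit y) :
    Computes K 1 S {z} :=
  Computes.arith .div hx hy fun θ => by
    have h₀ : y θ ≠ 0 := (Pi.isUnit_iff.1 hu θ).ne_zero
    simp [ArithOp.eval, h₀, ← h]

theorem Computes.neg {x : ∀ θ, L θ} (hx : x ∈ S) : Computes K 1 S {-x} := by
  have h₀ : Computes K 0 S {(0 : ∀ θ, L θ)} :=
    Computes.of_subset_union_constants (by simpa using Or.inr ⟨0, map_zero _⟩)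
  simpa using h₀.andThen (Set.finite_singleton _)
    (Computes.sub (Or.inr rfl) (Set.mem_union_left _ hx))

/-! ### Matrix arithmetic -/

/-- The set of entries of a matrix. -/
def entries {α β R : Type*} (A : Matrix α β R) : Set R :=
  Set.range fun x : α × β => A x.1 x.2

theorem mem_entries {α β R : Type*} (A : Matrix α β R) (i : α) (j : β) : A i j ∈ entries A :=
  ⟨(i, j), rfl⟩

theorem finite_entries {α β R : Type*} [Finite α] [Finite β] (A : Matrix α β R) :
    (entries A).Finite :=
  Set.finite_range _

section Matrices

variable {α : Type} [Fintype α] {A B : Matrix α α (∀ θ, L θ)}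

theorem Computes.matrix_sub (hA : entries A ⊆ S) (hB : entries B ⊆ S) :
    Computes K (Fintype.card α ^ 2) S (entries (A - B)) :=
  (Computes.range (c := fun _ => 1) fun x : α × α => Computes.sub (hA (mem_entries A x.1 x.2))
    (hB (mem_entries B x.1 x.2))).mono (by simp [sq])

theorem Computes.matrix_neg (hA : entries A ⊆ S) :
    Computes K (Fintype.card α ^ 2) S (entries (-A)) :=
  (Computes.range (c := fun _ => 1) fun x : α × α =>
    Computes.neg (hA (mem_entries A x.1 x.2))).mono (by simp [sq])

theorem exists_computes_matrix_mul {ω : ℝ} (hω : IsFeasibleExponent K ω) :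
    ∃ c : ℝ, 0 ≤ c ∧ ∀ N : ℕ, ∃ μ : ℕ, (μ : ℝ) ≤ c * (N : ℝ) ^ ω ∧
      ∀ {α : Type} [Fintype α] [DecidableEq α], Fintype.card α = N →
      ∀ {Θ : Type v} {L : Θ → Type u} [∀ θ, Field (L θ)] [∀ θ, Algebra K (L θ)]
        {S : Set (∀ θ, L θ)} {A B : Matrix α α (∀ θ, L θ)},
        entries A ⊆ S → entries B ⊆ S → Computes K μ S (entries (A * B)) := by
  obtain ⟨c, hc⟩ := hω
  refine ⟨max c 0, le_max_right _ _, fun N => ?_⟩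
  obtain ⟨p, out, hcost, hp⟩ := hc N
  refine ⟨p.cost, hcost.trans (mul_le_mul_of_nonneg_right (le_max_left _ _)
    (Real.rpow_nonneg (Nat.cast_nonneg _) _)), ?_⟩
  intro α _ _ hα Θ L _ _ S A B hA hB ι κ _ _ _ a b ha hb
  have e : α ≃ Fin N := Fintype.equivFinOfCardEq hα
  choose gA hgA using fun x : Fin N × Fin N => ha (hA (mem_entries A (e.symm x.1) (e.symm x.2)))
  choose gB hgB using fun x : Fin N × Fin N => ha (hB (mem_entries B (e.symm x.1) (e.symm x.2)))
  have d₁ : Derives K p.cost (a ∘ Sum.elim gA gB) fun x : Fin N × Fin N =>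
      (A * B) (e.symm x.1) (e.symm x.2) := by
    refine ⟨p, out, le_rfl, fun θ mem hm => ?_⟩
    let A' : Matrix (Fin N) (Fin N) (L θ) := fun i j => A (e.symm i) (e.symm j) θ
    let B' : Matrix (Fin N) (Fin N) (L θ) := fun i j => B (e.symm i) (e.symm j) θ
    obtain ⟨m, h₁, h₂⟩ := hp (L θ) A' B' mem (by
      rintro (x | x)
      · simp [hm, hgA, A']
      · simp [hm, hgB, B'])
    refine ⟨m, h₁, fun x => (h₂ x.1 x.2).trans ?_⟩
    simp only [Matrix.mul_apply, A', B', Finset.sum_apply, Pi.mul_apply]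
    exact Fintype.sum_equiv e.symm _ _ fun _ => rfl
  choose g hg using fun k => hb ⟨k, rfl⟩
  refine (((Derives.reindex a (Sum.elim gA gB)).trans d₁).trans
    (Derives.reindex _ fun k => (e (g k).1, e (g k).2))).mono (by omega) |>.cast_target ?_
  funext k
  simpa using hg k

end Matrices

end Derivations

/-! ### Block inversion of matrices -/

section Inversion

open Matrix

/-- An index set with `2 ^ k` elements, split recursively into two halves. -/
def Idx : ℕ → Type
  | 0 => Unit
  | k + 1 => Idx k ⊕ Idx k

instance instFintypeIdx : ∀ k, Fintype (Idx k)
  | 0 => inferInstanceAs (Fintype Unit)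
  | k + 1 =>
    have := instFintypeIdx k
    inferInstanceAs (Fintype (Idx k ⊕ Idx k))

instance instDecidableEqIdx : ∀ k, DecidableEq (Idx k)
  | 0 => inferInstanceAs (DecidableEq Unit)
  | k + 1 =>
    have := instDecidableEqIdx k
    inferInstanceAs (DecidableEq (Idx k ⊕ Idx k))

theorem card_idx (k : ℕ) : Fintype.card (Idx k) = 2 ^ k := by
  induction k with
  | zero => rfl
  | succ k ih =>
    rw [show Fintype.card (Idx (k + 1)) = Fintype.card (Idx k ⊕ Idx k) from rfl,
      Fintype.card_sum, ih, pow_succ, mul_two]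

/-- A polynomial in the entries of a matrix; where it does not vanish, recursive inversion by
Schur complements meets only invertible pivots. The Schur complement of the upper left block is
multiplied by the determinant of that block, which clears its denominators. -/
def pivotProd {R : Type*} [CommRing R] : ∀ k, Matrix (Idx k) (Idx k) R → R
  | 0, A => A () ()
  | k + 1, A =>
    let A' : Matrix (Idx k ⊕ Idx k) (Idx k ⊕ Idx k) R := A
    pivotProd k A'.toBlocks₁₁ * pivotProd k (A'.toBlocks₁₁.det • A'.toBlocks₂₂ -
      A'.toBlocks₂₁ * A'.toBlocks₁₁.adjugate * A'.toBlocks₁₂)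

section PivotProd

variable {R R' : Type*} [CommRing R] [CommRing R']

theorem map_pivotProd (φ : R →+* R') (k : ℕ) (A : Matrix (Idx k) (Idx k) R) :
    φ (pivotProd k A) = pivotProd k (A.map φ) := by
  induction k with
  | zero => rfl
  | succ k ih =>
    let A' : Matrix (Idx k ⊕ Idx k) (Idx k ⊕ Idx k) R := A
    have e : (A'.toBlocks₁₁.det • A'.toBlocks₂₂ -
        A'.toBlocks₂₁ * A'.toBlocks₁₁.adjugate * A'.toBlocks₁₂).map φ =
        (A'.toBlocks₁₁.map φ).det • A'.toBlocks₂₂.map φ -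
        A'.toBlocks₂₁.map φ * (A'.toBlocks₁₁.map φ).adjugate * A'.toBlocks₁₂.map φ := by
      have h₁ := RingHom.map_det φ A'.toBlocks₁₁
      have h₂ := RingHom.map_adjugate φ A'.toBlocks₁₁
      simp only [RingHom.mapMatrix_apply] at h₁ h₂
      rw [← h₁, ← h₂, ← Matrix.map_mul, ← Matrix.map_mul]
      ext i j
      simp only [map_apply, Matrix.sub_apply, Matrix.smul_apply, smul_eq_mul, map_sub, map_mul]
    calc φ (pivotProd (k + 1) A) = φ (pivotProd k A'.toBlocks₁₁) * φ (pivotProd k _) :=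
          map_mul φ _ _
      _ = _ := by rw [ih, ih, e]; rfl

theorem pivotProd_one (k : ℕ) : pivotProd k (1 : Matrix (Idx k) (Idx k) R) = 1 := by
  induction k with
  | zero => rfl
  | succ k ih =>
    have e : (1 : Matrix (Idx (k + 1)) (Idx (k + 1)) R) =
      fromBlocks (1 : Matrix (Idx k) (Idx k) R) 0 0 1 := (fromBlocks_one (l := Idx k)
        (m := Idx k) (α := R)).symm
    rw [e]
    simp [pivotProd, ih, -fromBlocks_one]

theorem exists_pivotProd_smul (k : ℕ) :
    ∃ e : ℕ, ∀ (c : R) (A : Matrix (Idx k) (Idx k) R),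
      pivotProd k (c • A) = c ^ e * pivotProd k A := by
  induction k with
  | zero => exact ⟨1, fun c A => by rw [pow_one]; rfl⟩
  | succ k ih =>
    obtain ⟨e, he⟩ := ih
    refine ⟨e + (2 ^ k + 1) * e, fun c A => ?_⟩
    let A' : Matrix (Idx k ⊕ Idx k) (Idx k ⊕ Idx k) R := A
    have hs : (c • A'.toBlocks₁₁).det • (c • A'.toBlocks₂₂) -
        c • A'.toBlocks₂₁ * (c • A'.toBlocks₁₁).adjugate * (c • A'.toBlocks₁₂) =
        c ^ (2 ^ k + 1) • (A'.toBlocks₁₁.det • A'.toBlocks₂₂ -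
          A'.toBlocks₂₁ * A'.toBlocks₁₁.adjugate * A'.toBlocks₁₂) := by
      obtain ⟨N, hN⟩ : ∃ N, 2 ^ k = N + 1 := Nat.exists_eq_succ_of_ne_zero (by positivity)
      rw [det_smul, adjugate_smul, card_idx, hN]
      simp only [smul_smul, Matrix.smul_mul, Matrix.mul_smul, smul_sub, Nat.add_sub_cancel]
      congr 2 <;> ring
    calc pivotProd (k + 1) (c • A) = pivotProd k (c • A'.toBlocks₁₁) * pivotProd k
          ((c • A'.toBlocks₁₁).det • (c • A'.toBlocks₂₂) -
            c • A'.toBlocks₂₁ * (c • A'.toBlocks₁₁).adjugate * (c • A'.toBlocks₁₂)) := rfl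
      _ = c ^ (e + (2 ^ k + 1) * e) * (pivotProd k A'.toBlocks₁₁ * pivotProd k
          (A'.toBlocks₁₁.det • A'.toBlocks₂₂ -
            A'.toBlocks₂₁ * A'.toBlocks₁₁.adjugate * A'.toBlocks₁₂)) := by
        rw [hs, he, he]; ring
      _ = _ := rfl

end PivotProd

/-- The inverse of `fromBlocks A B C D`, from the inverses `X` of `A` and `Y` of the negated Schur
complement. -/
theorem fromBlocks_mul_eq_one {R : Type*} [CommRing R] {α : Type*} [Fintype α] [DecidableEq α]
    {A B C D X Y : Matrix α α R} (hX : A * X = 1) (hY : (C * (X * B) - D) * Y = 1) :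
    fromBlocks A B C D *
      fromBlocks (X - X * B * Y * (C * X)) (X * B * Y) (Y * (C * X)) (-Y) = 1 := by
  have e₁ : A * (X * B * Y) = B * Y := by simp only [← Matrix.mul_assoc, hX, Matrix.one_mul]
  have e₂ : C * (X * B * Y) - D * Y = 1 := by
    rw [← hY]; simp only [Matrix.sub_mul, Matrix.mul_assoc]
  rw [fromBlocks_multiply, ← fromBlocks_one]
  congr 1
  · rw [Matrix.mul_sub, hX, ← Matrix.mul_assoc A, e₁]
    simp only [Matrix.mul_assoc]
    abel
  · rw [e₁]; simp
  · have : C * (X * B * Y * (C * X)) - D * (Y * (C * X)) = C * X := by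
      rw [← Matrix.mul_assoc C, ← Matrix.mul_assoc D, ← Matrix.sub_mul, e₂, Matrix.one_mul]
    rw [Matrix.mul_sub, sub_add, this, sub_self]
  · rw [← e₂]; simp [sub_eq_add_neg]

theorem entries_fromBlocks_subset {R α : Type*} {A B C D : Matrix α α R} {S : Set R}
    (hA : entries A ⊆ S) (hB : entries B ⊆ S) (hC : entries C ⊆ S) (hD : entries D ⊆ S) :
    entries (fromBlocks A B C D) ⊆ S := by
  rintro _ ⟨⟨i | i, j | j⟩, rfl⟩
  · exact hA (mem_entries A i j)
  · exact hB (mem_entries B i j)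
  · exact hC (mem_entries C i j)
  · exact hD (mem_entries D i j)

/-- Inversion within `O(N ^ ω)` operations. The recursion reduces size `2 N` to two inversions and
a constant number of multiplications of size `N`; since `2 < 2 ^ ω`, the costs of its levels form a
geometric progression. -/
theorem exists_computes_inverse {K : Type u} [Field K] {ω : ℝ} (hω : IsFeasibleExponent K ω) :
    ∃ c : ℝ, 0 ≤ c ∧ ∀ k : ℕ, ∃ μ : ℕ, (μ : ℝ) ≤ c * ((2 ^ k : ℕ) : ℝ) ^ ω ∧
      ∀ {Θ : Type (u + 1)} {L : Θ → Type u} [∀ θ, Field (L θ)] [∀ θ, Algebra K (L θ)]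
        {S : Set (∀ θ, L θ)} {A : Matrix (Idx k) (Idx k) (∀ θ, L θ)},
        IsUnit (pivotProd k A) → entries A ⊆ S →
        ∃ B, A * B = 1 ∧ Computes K μ S (entries B) := by
  have h2 := two_le_of_isFeasibleExponent hω
  obtain ⟨c, hc, hmul⟩ := exists_computes_matrix_mul hω
  -- the constant `C = 3 * c + 2` satisfies `2 * C + 6 * c + 3 ≤ 4 * C`, as the recursion requires
  refine ⟨3 * c + 2, by positivity, fun k => ?_⟩
  induction k with
  | zero =>
    refine ⟨1, by simp; linarith, ?_⟩
    intro Θ L _ _ S A hA hAS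
    obtain ⟨b, hb⟩ := hA.exists_right_inv
    refine ⟨fun _ _ => b, ?_, ?_⟩
    · refine Matrix.ext fun i j => ?_
      change ∑ x : Unit, A i x * b = 1
      rw [Fintype.sum_unique]
      exact hb
    · have h₁ : Computes K 0 S {(1 : ∀ θ, L θ)} :=
        Computes.of_subset_union_constants (by simpa using Or.inr ⟨1, map_one _⟩)
      have h₂ := h₁.andThen (Set.finite_singleton _) (Computes.div (Or.inr rfl)
        (Or.inl (hAS (mem_entries A () ()))) hb hA)
      have e : entries (fun _ _ => b : Matrix (Idx 0) (Idx 0) (∀ θ, L θ)) = {b} := by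
        have : Nonempty (Idx 0 × Idx 0) := ⟨((), ())⟩
        exact Set.range_const
      rw [e]
      exact h₂
  | succ k ih =>
    obtain ⟨μ, hμ, hinv⟩ := ih
    obtain ⟨ν, hν, hmul⟩ := hmul (2 ^ k)
    refine ⟨2 * μ + 6 * ν + 3 * (2 ^ k) ^ 2, ?_, ?_⟩
    · set N : ℝ := ((2 ^ k : ℕ) : ℝ) with hN
      have hN1 : 1 ≤ N := by rw [hN]; exact_mod_cast Nat.one_le_two_pow
      have e₁ : (((2 ^ (k + 1) : ℕ) : ℝ)) ^ ω = 2 ^ ω * N ^ ω := by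
        rw [← Real.mul_rpow (by norm_num) (by linarith), hN]
        push_cast
        ring_nf
      have e₂ : N ^ (2 : ℕ) ≤ N ^ ω := by
        rw [← Real.rpow_natCast]
        exact Real.rpow_le_rpow_of_exponent_le hN1 (by simpa using h2)
      have e₃ : (4 : ℝ) ≤ 2 ^ ω := by
        calc (4 : ℝ) = 2 ^ (2 : ℝ) := by norm_num
          _ ≤ 2 ^ ω := Real.rpow_le_rpow_of_exponent_le (by norm_num) h2
      have e₄ : 0 ≤ N ^ ω := by positivity
      have e₅ : (3 * c + 2) * (4 * N ^ ω) ≤ (3 * c + 2) * (2 ^ ω * N ^ ω) := by gcongr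
      rw [e₁]
      push_cast at hN ⊢
      rw [← hN]
      linarith
    · intro Θ L _ _ S A hA hAS
      obtain ⟨A₁, A₂, A₃, A₄, rfl⟩ : ∃ A₁ A₂ A₃ A₄ : Matrix (Idx k) (Idx k) (∀ θ, L θ),
        fromBlocks A₁ A₂ A₃ A₄ = A := ⟨_, _, _, _, fromBlocks_toBlocks _⟩
      have s₁ : entries A₁ ⊆ S := by
        rintro _ ⟨⟨i, j⟩, rfl⟩; exact hAS ⟨(Sum.inl i, Sum.inl j), rfl⟩
      have s₂ : entries A₂ ⊆ S := by
        rintro _ ⟨⟨i, j⟩, rfl⟩; exact hAS ⟨(Sum.inl i, Sum.inr j), rfl⟩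
      have s₃ : entries A₃ ⊆ S := by
        rintro _ ⟨⟨i, j⟩, rfl⟩; exact hAS ⟨(Sum.inr i, Sum.inl j), rfl⟩
      have s₄ : entries A₄ ⊆ S := by
        rintro _ ⟨⟨i, j⟩, rfl⟩; exact hAS ⟨(Sum.inr i, Sum.inr j), rfl⟩
      have hA' : IsUnit (pivotProd k A₁ * pivotProd k
        (A₁.det • A₄ - A₃ * A₁.adjugate * A₂)) := hA
      obtain ⟨u₁, u₂⟩ := IsUnit.mul_iff.1 hA'
      obtain ⟨X, hX, cX⟩ := hinv u₁ s₁
      have hadj : A₁.adjugate = A₁.det • X := by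
        calc A₁.adjugate = A₁.adjugate * (A₁ * X) := by rw [hX, Matrix.mul_one]
          _ = A₁.det • X := by rw [← Matrix.mul_assoc, adjugate_mul]; simp
      have hS : A₁.det • A₄ - A₃ * A₁.adjugate * A₂ = (-A₁.det) • (A₃ * (X * A₂) - A₄) := by
        rw [hadj]
        simp only [Matrix.mul_smul, Matrix.smul_mul, neg_smul, smul_sub, Matrix.mul_assoc]
        abel
      obtain ⟨e, he⟩ := exists_pivotProd_smul (R := ∀ θ, L θ) k
      rw [hS, he] at u₂
      -- `Y` inverts the negated Schur complement, a unit multiple of the one in `pivotProd`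
      have cY : ∀ S', S ⊆ S' → entries (A₃ * (X * A₂) - A₄) ⊆ S' → ∃ Y,
          (A₃ * (X * A₂) - A₄) * Y = 1 ∧ Computes K μ S' (entries Y) :=
        fun S' _ h => hinv (IsUnit.mul_iff.1 u₂).2 h
      obtain ⟨Y, hY, cY⟩ := cY (S ∪ entries X ∪ entries (A₃ * X) ∪ entries (X * A₂) ∪
        entries (A₃ * (X * A₂)) ∪ entries (A₃ * (X * A₂) - A₄))
        (fun x hx => by simp [hx]) (fun x hx => by simp [hx])
      refine ⟨fromBlocks (X - X * A₂ * Y * (A₃ * X)) (X * A₂ * Y) (Y * (A₃ * X)) (-Y),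
        fromBlocks_mul_eq_one hX hY, ?_⟩
      have hcard := card_idx k
      have fin := fun B : Matrix (Idx k) (Idx k) (∀ θ, L θ) => finite_entries B
      have cfinal := (cX.andThen (fin _) <|
        (hmul (A := A₃) (B := X) hcard (fun x hx => by simp [s₃ hx])
          (fun x hx => by simp [hx])).andThen (fin _) <|
        (hmul (A := X) (B := A₂) hcard (fun x hx => by simp [hx])
          (fun x hx => by simp [s₂ hx])).andThen (fin _) <|
        (hmul (A := A₃) (B := X * A₂) hcard (fun x hx => by simp [s₃ hx])
          (fun x hx => by simp [hx])).andThen (fin _) <|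
        (Computes.matrix_sub (A := A₃ * (X * A₂)) (B := A₄) (fun x hx => by simp [hx])
          (fun x hx => by simp [s₄ hx])).andThen (fin _) <|
        cY.andThen (fin _) <|
        (hmul (A := X * A₂) (B := Y) hcard (fun x hx => by simp [hx])
          (fun x hx => by simp [hx])).andThen (fin _) <|
        (hmul (A := Y) (B := A₃ * X) hcard (fun x hx => by simp [hx])
          (fun x hx => by simp [hx])).andThen (fin _) <|
        (hmul (A := X * A₂ * Y) (B := A₃ * X) hcard (fun x hx => by simp [hx])
          (fun x hx => by simp [hx])).andThen (fin _) <|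
        (Computes.matrix_sub (A := X) (B := X * A₂ * Y * (A₃ * X)) (fun x hx => by simp [hx])
          (fun x hx => by simp [hx])).andThen (fin _) <|
        (Computes.matrix_neg (A := Y) (fun x hx => by simp [hx])).andThen (fin _) <|
        Computes.of_subset (entries_fromBlocks_subset
          (A := X - X * A₂ * Y * (A₃ * X)) (B := X * A₂ * Y) (C := Y * (A₃ * X)) (D := -Y)
          (fun x hx => by simp [hx]) (fun x hx => by simp [hx])
          (fun x hx => by simp [hx]) (fun x hx => by simp [hx])))
      refine cfinal.mono ?_
      rw [hcard]
      omega

end Inversion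

/-! ### Counting products of two edges -/

section Edges

variable {V : Type}

/-- The exponent vector of `X_i X_j`, for an edge or loop `s(i, j)`. -/
noncomputable def edgeSum : Sym2 V → V →₀ ℕ :=
  Sym2.lift ⟨fun i j => Finsupp.single i 1 + Finsupp.single j 1, fun _ _ => add_comm _ _⟩

/-- The exponent vector of the product of the monomials of two edges or loops. -/
noncomputable def pairSum : Sym2 (Sym2 V) → V →₀ ℕ :=
  Sym2.lift ⟨fun e f => edgeSum e + edgeSum f, fun _ _ => add_comm _ _⟩

/-- The edges of the closed walk through `a`, `b`, `c`, `d`; it may use loops. -/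
def walkEdges (a b c d : V) : Set (Sym2 V) := {s(a, b), s(b, c), s(c, d), s(d, a)}

theorem edgeSum_mk (i j : V) : edgeSum s(i, j) = Finsupp.single i 1 + Finsupp.single j 1 := rfl

theorem pairSum_mk (e f : Sym2 V) : pairSum s(e, f) = edgeSum e + edgeSum f := rfl

theorem edgeSum_injective : Function.Injective (edgeSum : Sym2 V → V →₀ ℕ) := by
  intro e f
  induction e using Sym2.ind
  induction f using Sym2.ind
  rw [edgeSum_mk, edgeSum_mk,
    Finsupp.single_add_single_eq_single_add_single one_ne_zero one_ne_zero]
  simp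

/-- A product of four variables has at most three factorizations into two monomials of
degree two. -/
theorem eq_of_pairSum_eq {P : Sym2 (Sym2 V)} {a b c d : V}
    (h : pairSum P = pairSum s(s(a, b), s(c, d))) :
    P = s(s(a, b), s(c, d)) ∨ P = s(s(a, c), s(b, d)) ∨ P = s(s(a, d), s(b, c)) := by
  classical
  have two : ∀ r t c d : V, (Finsupp.single r 1 + Finsupp.single t 1 : V →₀ ℕ) =
      Finsupp.single c 1 + Finsupp.single d 1 → (r = c ∧ t = d) ∨ (r = d ∧ t = c) :=
    fun r t c d h => by
      simpa using (Finsupp.single_add_single_eq_single_add_single one_ne_zero one_ne_zero).1 h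
  have core : ∀ q r t : V, (Finsupp.single q 1 + (Finsupp.single r 1 + Finsupp.single t 1) :
      V →₀ ℕ) = Finsupp.single b 1 + (Finsupp.single c 1 + Finsupp.single d 1) →
      s(s(a, q), s(r, t)) = s(s(a, b), s(c, d)) ∨ s(s(a, q), s(r, t)) = s(s(a, c), s(b, d)) ∨
        s(s(a, q), s(r, t)) = s(s(a, d), s(b, c)) := by
    intro q r t h
    have hb : b = q ∨ b = r ∨ b = t := by
      have := DFunLike.congr_fun h b
      simp only [Finsupp.add_apply, Finsupp.single_apply] at this
      grind
    rcases hb with rfl | rfl | rfl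
    · rcases two _ _ _ _ (add_left_cancel h) with ⟨rfl, rfl⟩ | ⟨rfl, rfl⟩
      · exact Or.inl rfl
      · exact Or.inl (by rw [Sym2.eq_swap (a := r)])
    · rw [add_left_comm] at h
      rcases two _ _ _ _ (add_left_cancel h) with ⟨rfl, rfl⟩ | ⟨rfl, rfl⟩ <;> simp
    · rw [add_comm (Finsupp.single r 1), add_left_comm] at h
      rcases two _ _ _ _ (add_left_cancel h) with ⟨rfl, rfl⟩ | ⟨rfl, rfl⟩ <;>
        simp [Sym2.eq_swap (a := r)]
  induction P using Sym2.ind with | _ e f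
  induction e using Sym2.ind with | _ p q
  induction f using Sym2.ind with | _ r t
  simp only [pairSum_mk, edgeSum_mk] at h
  have ha : a = p ∨ a = q ∨ a = r ∨ a = t := by
    have := DFunLike.congr_fun h a
    simp only [Finsupp.add_apply, Finsupp.single_apply] at this
    grind
  rw [add_assoc (Finsupp.single a 1)] at h
  rcases ha with rfl | rfl | rfl | rfl
  · exact core _ _ _ (add_left_cancel (by rw [← h, add_assoc]))
  · rw [Sym2.eq_swap (a := p)]
    exact core _ _ _ (add_left_cancel (by rw [← h]; abel))
  · rw [Sym2.eq_swap (a := s(p, q))]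
    exact core _ _ _ (add_left_cancel (by rw [← h]; abel))
  · rw [Sym2.eq_swap (a := s(p, q)), Sym2.eq_swap (a := r)]
    exact core _ _ _ (add_left_cancel (by rw [← h]; abel))

/-- Two factorizations of the same monomial form a closed walk of length four, in which they
alternate. -/
theorem exists_walk_of_pairSum_eq {P Q : Sym2 (Sym2 V)} (h : pairSum P = pairSum Q) (hne : P ≠ Q) :
    ∃ a b c d : V, a ≠ c ∧ b ≠ d ∧ P = s(s(a, b), s(c, d)) ∧ Q = s(s(b, c), s(d, a)) := by
  induction P using Sym2.ind with | _ e f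
  induction e using Sym2.ind with | _ a b
  induction f using Sym2.ind with | _ c d
  rcases eq_of_pairSum_eq h.symm with rfl | rfl | rfl
  · exact absurd rfl hne
  · refine ⟨a, b, d, c, ?_, ?_, by simp, by grind⟩
    · rintro rfl; exact hne (by grind)
    · rintro rfl; exact hne rfl
  · refine ⟨a, b, c, d, ?_, ?_, by simp, by grind⟩
    · rintro rfl; exact hne (by grind)
    · rintro rfl; exact hne (by grind)

/-- The edges of a walk determine the monomial it factors: its variables are the vertices of the
walk, those with a loop being squared. -/
theorem pairSum_apply_of_walk {a b c d : V} (hac : a ≠ c) (hbd : b ≠ d) (v : V) :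
    pairSum s(s(a, b), s(c, d)) v =
      open Classical in (if ∃ e ∈ walkEdges a b c d, v ∈ e then 1 else 0) +
        if s(v, v) ∈ walkEdges a b c d then 1 else 0 := by
  classical
  have h₁ : (∃ e ∈ walkEdges a b c d, v ∈ e) ↔ (v = a ∨ v = b ∨ v = c ∨ v = d) := by
    simp [walkEdges]; tauto
  have h₂ : s(v, v) ∈ walkEdges a b c d ↔
      (v = a ∧ v = b ∨ v = b ∧ v = c ∨ v = c ∧ v = d ∨ v = d ∧ v = a) := by
    simp [walkEdges]; tauto
  simp only [pairSum_mk, edgeSum_mk, Finsupp.add_apply, Finsupp.single_apply, h₁, h₂]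
  grind

/-- A factorization by edges of the walk is one of the two that alternate in the walk. -/
theorem eq_of_walk {a b c d : V} {P : Sym2 (Sym2 V)} (hP : ∀ e ∈ P, e ∈ walkEdges a b c d)
    (h : pairSum P = pairSum s(s(a, b), s(c, d))) :
    P = s(s(a, b), s(c, d)) ∨ P = s(s(b, c), s(d, a)) := by
  induction P using Sym2.ind with | _ e f
  have he := hP e (by simp)
  have h' : edgeSum e + edgeSum f = edgeSum s(b, c) + edgeSum s(d, a) := by
    rw [← pairSum_mk, h, pairSum_mk]
    simp only [edgeSum_mk]
    abel
  rw [pairSum_mk, pairSum_mk] at h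
  rcases he with rfl | rfl | rfl | rfl
  · rw [edgeSum_injective (add_left_cancel h)]; simp
  · rw [edgeSum_injective (add_left_cancel h')]; simp
  · rw [add_comm (edgeSum s(a, b))] at h
    rw [edgeSum_injective (add_left_cancel h)]; simp
  · rw [add_comm (edgeSum s(b, c))] at h'
    rw [edgeSum_injective (add_left_cancel h')]; simp

/-- The relations of the three types are the closed walks of length four whose opposite vertices
are distinct. -/
theorem copies_eq_walks (E : Set (Sym2 V)) :
    copiesIn pattern₁ E ∪ copiesIn pattern₂ E ∪ copiesIn pattern₃ E =
      {S | S ⊆ E ∧ ∃ a b c d, a ≠ c ∧ b ≠ d ∧ S = walkEdges a b c d} := by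
  have inj2 : ∀ a b : V, a ≠ b → Function.Injective ![a, b] := fun a b h i j => by
    fin_cases i <;> fin_cases j <;> simp [h, h.symm]
  have inj3 : ∀ a b c : V, a ≠ b → a ≠ c → b ≠ c → Function.Injective ![a, b, c] :=
    fun a b c h₁ h₂ h₃ i j => by
      fin_cases i <;> fin_cases j <;> simp [h₁, h₂, h₃, h₁.symm, h₂.symm, h₃.symm]
  have inj4 : ∀ a b c d : V, a ≠ b → a ≠ c → a ≠ d → b ≠ c → b ≠ d → c ≠ d →
      Function.Injective ![a, b, c, d] :=
    fun a b c d h₁ h₂ h₃ h₄ h₅ h₆ i j => by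
      fin_cases i <;> fin_cases j <;> simp [h₁, h₂, h₃, h₄, h₅, h₆, h₁.symm, h₂.symm, h₃.symm,
        h₄.symm, h₅.symm, h₆.symm]
  have loop : ∀ a c d : V, a ≠ c → a ≠ d → walkEdges a a c d ⊆ E →
      walkEdges a a c d ∈ copiesIn pattern₁ E ∪ copiesIn pattern₂ E ∪ copiesIn pattern₃ E := by
    intro a c d hac had hE
    by_cases hcd : c = d
    · subst hcd
      refine Or.inr ⟨hE, ![a, c], inj2 a c hac, ?_⟩
      simp only [walkEdges, pattern₃, Set.image_insert_eq, Set.image_singleton, Sym2.map_mk]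
      ext e; simp; grind
    · refine Or.inl (Or.inr ⟨hE, ![a, c, d], inj3 a c d hac had hcd, ?_⟩)
      simp only [walkEdges, pattern₂, Set.image_insert_eq, Set.image_singleton, Sym2.map_mk]
      ext e; simp; grind
  have rot : ∀ a b c d : V, walkEdges a b c d = walkEdges b c d a := fun a b c d => by
    ext e; simp [walkEdges]; tauto
  ext S
  constructor
  · rintro ((⟨hE, φ, hφ, rfl⟩ | ⟨hE, φ, hφ, rfl⟩) | ⟨hE, φ, hφ, rfl⟩)
    · refine ⟨hE, φ 0, φ 1, φ 2, φ 3, hφ.ne (by decide), hφ.ne (by decide), ?_⟩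
      simp [walkEdges, pattern₁, Set.image_insert_eq]
    · refine ⟨hE, φ 0, φ 0, φ 1, φ 2, hφ.ne (by decide), hφ.ne (by decide), ?_⟩
      simp only [walkEdges, pattern₂, Set.image_insert_eq, Set.image_singleton, Sym2.map_mk]
      ext e; simp; grind
    · refine ⟨hE, φ 0, φ 0, φ 1, φ 1, hφ.ne (by decide), hφ.ne (by decide), ?_⟩
      simp only [walkEdges, pattern₃, Set.image_insert_eq, Set.image_singleton, Sym2.map_mk]
      ext e; simp; grind
  · rintro ⟨hE, a, b, c, d, hac, hbd, rfl⟩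
    by_cases h₁ : a = b
    · subst h₁; exact loop a c d hac hbd hE
    by_cases h₂ : b = c
    · subst h₂; rw [rot] at hE ⊢; exact loop b d a hbd hac.symm hE
    by_cases h₃ : c = d
    · subst h₃; rw [rot, rot] at hE ⊢; exact loop c a b hac.symm hbd.symm hE
    by_cases h₄ : d = a
    · subst h₄; rw [rot, rot, rot] at hE ⊢; exact loop d b c hbd.symm hac hE
    refine Or.inl (Or.inl ⟨hE, ![a, b, c, d],
      inj4 a b c d h₁ hac (Ne.symm h₄) h₂ hbd h₃, ?_⟩)
    simp [walkEdges, pattern₁, Set.image_insert_eq]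

/-- Fibres with at most three elements satisfy `1 = r - r.choose 2 + r.choose 3`. -/
theorem card_image_add_card_pairs {X Y : Type*} [DecidableEq X] [DecidableEq Y] (s : Finset X)
    (g : X → Y) (h : ∀ y, (s.filter (g · = y)).card ≤ 3) :
    (s.image g).card + ((s.powersetCard 2).filter fun p => ∀ x ∈ p, ∀ y ∈ p, g x = g y).card =
      s.card + ((s.image g).filter fun y => (s.filter (g · = y)).card = 3).card := by
  have hpairs : ((s.powersetCard 2).filter fun p => ∀ x ∈ p, ∀ y ∈ p, g x = g y) =
      (s.image g).biUnion fun y => (s.filter (g · = y)).powersetCard 2 := by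
    ext p
    simp only [Finset.mem_filter, Finset.mem_powersetCard, Finset.mem_biUnion, Finset.mem_image]
    constructor
    · rintro ⟨⟨hs, hc⟩, hp⟩
      obtain ⟨x, hx⟩ : p.Nonempty := Finset.card_pos.1 (by omega)
      exact ⟨g x, ⟨x, hs hx, rfl⟩, fun y hy => Finset.mem_filter.2 ⟨hs hy, hp y hy x hx⟩, hc⟩
    · rintro ⟨y, -, hs, hc⟩
      refine ⟨⟨fun x hx => (Finset.mem_filter.1 (hs hx)).1, hc⟩, fun x hx x' hx' => ?_⟩
      rw [(Finset.mem_filter.1 (hs hx)).2, (Finset.mem_filter.1 (hs hx')).2]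
  have hdisj : ((s.image g : Finset Y) : Set Y).PairwiseDisjoint
      fun y => (s.filter (g · = y)).powersetCard 2 := by
    intro y _ y' _ hne
    refine Finset.disjoint_left.2 fun p hp hp' => hne ?_
    simp only [Finset.mem_powersetCard] at hp hp'
    obtain ⟨x, hx⟩ : p.Nonempty := Finset.card_pos.1 (by omega)
    rw [← (Finset.mem_filter.1 (hp.1 hx)).2, ← (Finset.mem_filter.1 (hp'.1 hx)).2]
  rw [hpairs, Finset.card_biUnion hdisj, Finset.card_eq_sum_card_image g s, Finset.card_filter,
    Finset.card_eq_sum_ones, ← Finset.sum_add_distrib, ← Finset.sum_add_distrib]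
  refine Finset.sum_congr rfl fun y hy => ?_
  obtain ⟨x, hx, rfl⟩ := Finset.mem_image.1 hy
  have h₁ : 0 < (s.filter (g · = g x)).card :=
    Finset.card_pos.2 ⟨x, Finset.mem_filter.2 ⟨hx, rfl⟩⟩
  have h₃ := h (g x)
  rw [Finset.card_powersetCard]
  generalize (s.filter (g · = g x)).card = r at *
  interval_cases r <;> rfl

theorem card_fiber_le_three [DecidableEq V] (s : Finset (Sym2 (Sym2 V))) (σ : V →₀ ℕ) :
    (s.filter (pairSum · = σ)).card ≤ 3 := by
  rcases (s.filter (pairSum · = σ)).eq_empty_or_nonempty with h | ⟨P, hP⟩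
  · simp [h]
  · obtain ⟨-, rfl⟩ := Finset.mem_filter.1 hP
    induction P using Sym2.ind with | _ e f
    induction e using Sym2.ind with | _ a b
    induction f using Sym2.ind with | _ c d
    refine (Finset.card_le_card (t := {s(s(a, b), s(c, d)), s(s(a, c), s(b, d)),
      s(s(a, d), s(b, c))}) fun Q hQ => ?_).trans Finset.card_le_three
    simpa using eq_of_pairSum_eq (Finset.mem_filter.1 hQ).2

/-- Relations correspond to pairs of distinct factorizations of the same monomial. -/
theorem ncard_copies [DecidableEq V] (E : Finset (Sym2 V)) :
    (copiesIn pattern₁ (E : Set (Sym2 V)) ∪ copiesIn pattern₂ (E : Set (Sym2 V)) ∪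
      copiesIn pattern₃ (E : Set (Sym2 V))).ncard =
      ((E.sym2.powersetCard 2).filter
        fun p => ∀ P ∈ p, ∀ Q ∈ p, pairSum P = pairSum Q).card := by
  let F : Finset (Sym2 (Sym2 V)) → Set (Sym2 V) := fun p => {e | ∃ P ∈ p, e ∈ P}
  have hwalk : ∀ a b c d : V,
      F {s(s(a, b), s(c, d)), s(s(b, c), s(d, a))} = walkEdges a b c d := by
    intro a b c d
    ext e
    simp [F, walkEdges]
    tauto
  have hmem : ∀ p ∈ (E.sym2.powersetCard 2).filter
      (fun p => ∀ P ∈ p, ∀ Q ∈ p, pairSum P = pairSum Q), ∃ a b c d, a ≠ c ∧ b ≠ d ∧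
      p = {s(s(a, b), s(c, d)), s(s(b, c), s(d, a))} := by
    intro p hp
    obtain ⟨hp, hsum⟩ := Finset.mem_filter.1 hp
    obtain ⟨P, Q, hne, rfl⟩ := Finset.card_eq_two.1 (Finset.mem_powersetCard.1 hp).2
    obtain ⟨a, b, c, d, hac, hbd, rfl, rfl⟩ :=
      exists_walk_of_pairSum_eq (hsum P (by simp) Q (by simp)) hne
    exact ⟨a, b, c, d, hac, hbd, rfl⟩
  have himage : copiesIn pattern₁ (E : Set (Sym2 V)) ∪ copiesIn pattern₂ (E : Set (Sym2 V)) ∪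
      copiesIn pattern₃ (E : Set (Sym2 V)) = F '' ((E.sym2.powersetCard 2).filter
        fun p => ∀ P ∈ p, ∀ Q ∈ p, pairSum P = pairSum Q : Finset _) := by
    rw [copies_eq_walks]
    ext S
    constructor
    · rintro ⟨hE, a, b, c, d, hac, hbd, rfl⟩
      refine ⟨{s(s(a, b), s(c, d)), s(s(b, c), s(d, a))}, ?_, hwalk a b c d⟩
      have hE' : ∀ e ∈ walkEdges a b c d, e ∈ E := hE
      simp only [walkEdges, Set.mem_insert_iff, Set.mem_singleton_iff, forall_eq_or_imp,
        forall_eq] at hE'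
      have hsum : pairSum s(s(a, b), s(c, d)) = pairSum s(s(b, c), s(d, a)) := by
        simp only [pairSum_mk, edgeSum_mk]; abel
      simp only [Finset.coe_filter, Finset.mem_powersetCard, Set.mem_ofPred_eq]
      refine ⟨⟨?_, Finset.card_pair ?_⟩, by simp [hsum]⟩
      · intro P hP
        rcases Finset.mem_insert.1 hP with rfl | hP
        · simp [hE']
        · rw [Finset.mem_singleton.1 hP]; simp [hE']
      · intro h; grind
    · rintro ⟨p, hp, rfl⟩
      obtain ⟨a, b, c, d, hac, hbd, rfl⟩ := hmem p hp
      refine ⟨?_, a, b, c, d, hac, hbd, hwalk a b c d⟩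
      rintro e ⟨P, hP, he⟩
      exact Finset.mem_sym2_iff.1
        ((Finset.mem_powersetCard.1 (Finset.mem_filter.1 hp).1).1 hP) e he
  have hinj : Set.InjOn F ((E.sym2.powersetCard 2).filter
      fun p => ∀ P ∈ p, ∀ Q ∈ p, pairSum P = pairSum Q : Finset _) := by
    intro p hp p' hp' hF
    have hc : p.card = p'.card := by
      rw [(Finset.mem_powersetCard.1 (Finset.mem_filter.1 hp).1).2,
        (Finset.mem_powersetCard.1 (Finset.mem_filter.1 hp').1).2]
    refine (Finset.eq_of_subset_of_card_le ?_ hc.le).symm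
    obtain ⟨a, b, c, d, hac, hbd, rfl⟩ := hmem p hp
    have hsum' := (Finset.mem_filter.1 hp').2
    obtain ⟨a', b', c', d', hac', hbd', rfl⟩ := hmem p' hp'
    have hw : walkEdges a b c d = walkEdges a' b' c' d' := by rw [← hwalk, ← hwalk]; exact hF
    have hσ : pairSum s(s(a', b'), s(c', d')) = pairSum s(s(a, b), s(c, d)) := by
      ext v
      rw [pairSum_apply_of_walk hac hbd, pairSum_apply_of_walk hac' hbd', hw]
    intro P hP
    have hP₁ : ∀ e ∈ P, e ∈ walkEdges a b c d := fun e he => by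
      rw [hw, ← hwalk]; exact ⟨P, hP, he⟩
    simpa using eq_of_walk hP₁ ((hsum' P hP _ (by simp)).trans hσ)
  rw [himage, hinj.ncard_image, Set.ncard_coe_finset]

/-- The monomials with three factorizations correspond to the cliques with four vertices. -/
theorem ncard_cliqueSet_four [DecidableEq V] (E : Finset (Sym2 V)) (G : SimpleGraph V)
    (hG : ∀ i j, G.Adj i j ↔ i ≠ j ∧ s(i, j) ∈ E) :
    (G.cliqueSet 4).ncard = ((E.sym2.image pairSum).filter
      fun σ => (E.sym2.filter (pairSum · = σ)).card = 3).card := by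
  let F : Finset V → V →₀ ℕ := fun s => Finsupp.indicator s fun _ _ => 1
  have hF : ∀ a b c d : V, a ≠ b → a ≠ c → a ≠ d → b ≠ c → b ≠ d → c ≠ d →
      F {a, b, c, d} = pairSum s(s(a, b), s(c, d)) := by
    intro a b c d h₁ h₂ h₃ h₄ h₅ h₆
    ext v
    simp only [F, Finsupp.indicator_apply, pairSum_mk, edgeSum_mk, Finsupp.add_apply,
      Finsupp.single_apply]
    grind
  have himage : F '' G.cliqueSet 4 = ((E.sym2.image pairSum).filter
      fun σ => (E.sym2.filter (pairSum · = σ)).card = 3 : Finset _) := by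
    ext σ
    simp only [Finset.coe_filter, Finset.mem_image, Set.mem_image, Set.mem_ofPred_eq,
      SimpleGraph.mem_cliqueSet_iff]
    constructor
    · rintro ⟨s, ⟨hs, hcard⟩, rfl⟩
      obtain ⟨a, b, c, d, h₁, h₂, h₃, h₄, h₅, h₆, rfl⟩ := Finset.card_eq_four.1 hcard
      rw [hF a b c d h₁ h₂ h₃ h₄ h₅ h₆]
      have adj : ∀ i ∈ ({a, b, c, d} : Finset V), ∀ j ∈ ({a, b, c, d} : Finset V), i ≠ j →
          s(i, j) ∈ E := fun i hi j hj hij => ((hG i j).1 (hs hi hj hij)).2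
      have hab := adj a (by simp) b (by simp) h₁
      have hac := adj a (by simp) c (by simp) h₂
      have had := adj a (by simp) d (by simp) h₃
      have hbc := adj b (by simp) c (by simp) h₄
      have hbd := adj b (by simp) d (by simp) h₅
      have hcd := adj c (by simp) d (by simp) h₆
      refine ⟨⟨_, Finset.mk_mem_sym2_iff.2 ⟨hab, hcd⟩, rfl⟩,
        le_antisymm (card_fiber_le_three _ _) ?_⟩
      have hthree : ({s(s(a, b), s(c, d)), s(s(a, c), s(b, d)), s(s(a, d), s(b, c))} :
          Finset (Sym2 (Sym2 V))).card = 3 :=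
        Finset.card_eq_three.2 ⟨_, _, _, by simp [*], by simp [*],
          by simp [*, h₁.symm, h₄.symm, h₂.symm, h₃.symm, h₅.symm, h₆.symm], rfl⟩
      rw [← hthree]
      refine Finset.card_le_card fun P hP => ?_
      have e₁ : pairSum s(s(a, c), s(b, d)) = pairSum s(s(a, b), s(c, d)) := by
        simp only [pairSum_mk, edgeSum_mk]; abel
      have e₂ : pairSum s(s(a, d), s(b, c)) = pairSum s(s(a, b), s(c, d)) := by
        simp only [pairSum_mk, edgeSum_mk]; abel
      simp only [Finset.mem_insert, Finset.mem_singleton] at hP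
      rcases hP with rfl | rfl | rfl <;> simp [*]
    · rintro ⟨⟨P, hP, rfl⟩, hcard⟩
      induction P using Sym2.ind with | _ e f
      induction e using Sym2.ind with | _ a b
      induction f using Sym2.ind with | _ c d
      have hsub : E.sym2.filter (pairSum · = pairSum s(s(a, b), s(c, d))) ⊆
          {s(s(a, b), s(c, d)), s(s(a, c), s(b, d)), s(s(a, d), s(b, c))} := fun Q hQ => by
        simpa using eq_of_pairSum_eq (Finset.mem_filter.1 hQ).2
      have heq := Finset.eq_of_subset_of_card_le hsub (Finset.card_le_three.trans hcard.ge)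
      rw [heq] at hcard
      have hE : ∀ Q ∈ ({s(s(a, b), s(c, d)), s(s(a, c), s(b, d)), s(s(a, d), s(b, c))} :
          Finset (Sym2 (Sym2 V))), Q ∈ E.sym2 := fun Q hQ => by
        rw [← heq] at hQ; exact (Finset.mem_filter.1 hQ).1
      have e₁ := Finset.mk_mem_sym2_iff.1 (hE s(s(a, b), s(c, d)) (by simp))
      have e₂ := Finset.mk_mem_sym2_iff.1 (hE s(s(a, c), s(b, d)) (by simp))
      have e₃ := Finset.mk_mem_sym2_iff.1 (hE s(s(a, d), s(b, c)) (by simp))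
      -- two equal variables would make two of the three factorizations coincide
      have two : ∀ P Q : Sym2 (Sym2 V), ({P, Q, Q} : Finset _).card ≠ 3 ∧
          ({P, P, Q} : Finset _).card ≠ 3 ∧ ({P, Q, P} : Finset _).card ≠ 3 := fun P Q => by
        have := Finset.card_le_two (a := P) (b := Q)
        refine ⟨?_, ?_, ?_⟩
        · simp only [Finset.insert_eq_of_mem (Finset.mem_singleton_self Q)]; omega
        · simp only [Finset.insert_eq_of_mem (Finset.mem_insert_self P {Q})]; omega
        · rw [Finset.insert_comm, Finset.insert_eq_of_mem (Finset.mem_singleton_self P),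
            Finset.pair_comm]; omega
      have h₁ : a ≠ b := by
        rintro rfl; rw [show s(s(a, d), s(a, c)) = s(s(a, c), s(a, d)) by simp] at hcard
        exact (two _ _).1 hcard
      have h₂ : a ≠ c := by
        rintro rfl; rw [show s(s(a, d), s(b, a)) = s(s(a, b), s(a, d)) by grind] at hcard
        exact (two _ _).2.2 hcard
      have h₃ : a ≠ d := by
        rintro rfl; rw [show s(s(a, c), s(b, a)) = s(s(a, b), s(c, a)) by grind] at hcard
        exact (two _ _).2.1 hcard
      have h₄ : b ≠ c := by rintro rfl; exact (two _ _).2.1 hcard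
      have h₅ : b ≠ d := by
        rintro rfl; rw [show s(s(a, b), s(b, c)) = s(s(a, b), s(c, b)) by grind] at hcard
        exact (two _ _).2.2 hcard
      have h₆ : c ≠ d := by
        rintro rfl; exact (two _ _).1 hcard
      refine ⟨{a, b, c, d}, ⟨?_, Finset.card_eq_four.2
        ⟨a, b, c, d, h₁, h₂, h₃, h₄, h₅, h₆, rfl⟩⟩, hF a b c d h₁ h₂ h₃ h₄ h₅ h₆⟩
      intro i hi j hj hij
      refine (hG i j).2 ⟨hij, ?_⟩
      simp only [Finset.coe_insert, Finset.coe_singleton, Set.mem_insert_iff,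
        Set.mem_singleton_iff] at hi hj
      rcases hi with rfl | rfl | rfl | rfl <;> rcases hj with rfl | rfl | rfl | rfl <;>
        first
        | exact absurd rfl hij
        | simp [e₁, e₂, e₃]
        | (rw [Sym2.eq_swap]; simp [e₁, e₂, e₃])
  have hinj : Set.InjOn F (G.cliqueSet 4) := by
    intro s _ t _ h
    ext v
    have := DFunLike.congr_fun h v
    simp only [F, Finsupp.indicator_apply] at this
    grind
  rw [← hinj.ncard_image, himage, Set.ncard_coe_finset]

end Edges

/-! ### The size of `M²` -/

section Support

variable {n : ℕ}

theorem degree_cons (a : ℕ) (μ : Fin n →₀ ℕ) : (Finsupp.cons a μ).degree = a + μ.degree := by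
  simp [Finsupp.degree_eq_sum, Fin.sum_univ_succ]

theorem tail_add (γ δ : Fin (n + 1) →₀ ℕ) : (γ + δ).tail = γ.tail + δ.tail := by
  ext i; simp [Finsupp.tail_apply]

theorem eq_of_tail_eq {γ δ : Fin (n + 1) →₀ ℕ} (hd : γ.degree = δ.degree)
    (h : γ.tail = δ.tail) : γ = δ := by
  rw [← Finsupp.cons_tail γ, ← Finsupp.cons_tail δ, degree_cons, degree_cons, h] at hd
  rw [← Finsupp.cons_tail γ, ← Finsupp.cons_tail δ, h, Nat.add_right_cancel hd]

theorem degree_edgeSum {V : Type} (e : Sym2 V) : (edgeSum e).degree = 2 := by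
  induction e using Sym2.ind
  simp [edgeSum_mk]

theorem exists_edgeSum_eq {V : Type} {γ : V →₀ ℕ} (h : γ.degree = 2) : ∃ e, edgeSum e = γ := by
  classical
  have hc : γ.toMultiset.card = 2 := by rw [Finsupp.card_toMultiset]; exact h
  obtain ⟨i, j, hij⟩ := Multiset.card_eq_two.1 hc
  refine ⟨s(i, j), ?_⟩
  rw [← Finsupp.toMultiset_toFinsupp γ, hij, edgeSum_mk,
    show ({i, j} : Multiset V) = {i} + {j} from rfl,
    map_add, Multiset.toFinsupp_singleton, Multiset.toFinsupp_singleton]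

theorem mem_edgesAndLoops (M : Finset (Fin n →₀ ℕ)) (e : Sym2 (Fin (n + 1))) :
    e ∈ edgesAndLoops M ↔ edgeSum e ∈ homogenizedSupport M := by
  induction e using Sym2.ind with | _ i j
  have hdiag : s(i, j) ∈ Sym2.diag '' loopVertices M ↔ i = j ∧
      Finsupp.single i 2 ∈ homogenizedSupport M := by
    constructor
    · rintro ⟨k, hk, h⟩
      have h' : k = i ∧ k = j ∨ k = j ∧ k = i := by simpa [Sym2.diag] using h
      obtain ⟨rfl, rfl⟩ : k = i ∧ k = j := by tauto
      exact ⟨rfl, hk⟩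
    · rintro ⟨rfl, h⟩
      exact ⟨i, h, rfl⟩
  rw [edgesAndLoops, Set.mem_union, hdiag, SimpleGraph.mem_edgeSet, edgeSum_mk]
  by_cases hij : i = j
  · subst hij
    simp [supportGraph, ← Finsupp.single_add]
  · simp [supportGraph, hij]

theorem edgeSum_mem_homogenizedSupport {M : Finset (Fin n →₀ ℕ)} (hM : ∀ μ ∈ M, μ.degree ≤ 2)
    (e : Sym2 (Fin (n + 1))) : edgeSum e ∈ homogenizedSupport M ↔ (edgeSum e).tail ∈ M := by
  constructor
  · rintro ⟨μ, hμ, h⟩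
    rwa [h, Finsupp.tail_cons]
  · refine fun h => ⟨_, h, eq_of_tail_eq ?_ (by rw [Finsupp.tail_cons])⟩
    have := hM _ h
    rw [degree_cons, degree_edgeSum]
    omega

/-- The size of `M²`, by counting the factorizations of its monomials. -/
theorem card_add_self_add_lambdaCount {M : Finset (Fin n →₀ ℕ)} (hM : ∀ μ ∈ M, μ.degree ≤ 2) :
    (M + M).card + lambdaCount M = (M.card + 1).choose 2 + cliqueCount₄ M := by
  classical
  let E : Finset (Sym2 (Fin (n + 1))) :=
    Finset.univ.filter fun e => edgeSum e ∈ homogenizedSupport M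
  have hE : ∀ e, e ∈ E ↔ edgeSum e ∈ homogenizedSupport M := fun e => by simp [E]
  have hE' : (E : Set (Sym2 (Fin (n + 1)))) = edgesAndLoops M := by
    ext e; rw [mem_edgesAndLoops, ← hE, Finset.mem_coe]
  have himage : E.image (fun e => (edgeSum e).tail) = M := by
    ext μ
    simp only [Finset.mem_image]
    constructor
    · rintro ⟨e, he, rfl⟩
      exact (edgeSum_mem_homogenizedSupport hM e).1 ((hE e).1 he)
    · intro hμ
      have := hM μ hμ
      obtain ⟨e, he⟩ := exists_edgeSum_eq (γ := Finsupp.cons (2 - μ.degree) μ)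
        (by rw [degree_cons]; omega)
      exact ⟨e, (hE e).2 (he ▸ ⟨μ, hμ, rfl⟩), by rw [he, Finsupp.tail_cons]⟩
  have hcard : M.card = E.card := by
    conv_lhs => rw [← himage]
    exact Finset.card_image_of_injective _ fun e f h =>
      edgeSum_injective (eq_of_tail_eq (by rw [degree_edgeSum, degree_edgeSum]) h)
  have hsum : M + M = (E.sym2.image pairSum).image Finsupp.tail := by
    ext σ
    constructor
    · intro hσ
      obtain ⟨μ, hμ, μ', hμ', rfl⟩ := Finset.mem_add.1 hσ
      rw [← himage] at hμ hμ'
      obtain ⟨e, he, rfl⟩ := Finset.mem_image.1 hμ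
      obtain ⟨f, hf, rfl⟩ := Finset.mem_image.1 hμ'
      exact Finset.mem_image.2 ⟨_, Finset.mem_image.2
        ⟨s(e, f), Finset.mk_mem_sym2_iff.2 ⟨he, hf⟩, rfl⟩, tail_add _ _⟩
    · intro hσ
      obtain ⟨γ, hγ, rfl⟩ := Finset.mem_image.1 hσ
      obtain ⟨P, hP, rfl⟩ := Finset.mem_image.1 hγ
      induction P using Sym2.ind with | _ e f
      obtain ⟨he, hf⟩ := Finset.mk_mem_sym2_iff.1 hP
      rw [pairSum_mk, tail_add]
      exact Finset.add_mem_add (himage ▸ Finset.mem_image_of_mem (fun e => (edgeSum e).tail) he)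
        (himage ▸ Finset.mem_image_of_mem (fun e => (edgeSum e).tail) hf)
  have hdeg : ∀ P : Sym2 (Sym2 (Fin (n + 1))), (pairSum P).degree = 4 := fun P => by
    induction P using Sym2.ind with | _ e f
    rw [pairSum_mk, map_add, degree_edgeSum, degree_edgeSum]
  have hcard' : (M + M).card = (E.sym2.image pairSum).card := by
    rw [hsum]
    refine Finset.card_image_of_injOn fun γ hγ δ hδ h => eq_of_tail_eq ?_ h
    obtain ⟨P, -, rfl⟩ := Finset.mem_image.1 hγ
    obtain ⟨Q, -, rfl⟩ := Finset.mem_image.1 hδ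
    rw [hdeg, hdeg]
  rw [lambdaCount, cliqueCount₄, hcard', hcard, ← hE', ncard_copies,
    ncard_cliqueSet_four E _ fun i j => by rw [hE, edgeSum_mk]; rfl, ← Finset.card_sym2]
  exact card_image_add_card_pairs _ _ (card_fiber_le_three _)

end Support

/-! ### A system whose multiples span -/

section Witness

variable {n : ℕ}

theorem exists_isMatching_ncard_eq {V : Type} [Finite V] (G : SimpleGraph V) :
    ∃ A : G.Subgraph, A.IsMatching ∧ A.edgeSet.ncard = matchingNumber G := by
  have := Fintype.ofFinite V
  refine Nat.sSup_mem (s := {k | ∃ A : G.Subgraph, A.IsMatching ∧ A.edgeSet.ncard = k})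
    ⟨0, ⊥, ?_, by simp⟩ ⟨Nat.card (Sym2 V), ?_⟩
  · intro v hv
    exact absurd hv (by simp)
  · rintro _ ⟨A, -, rfl⟩
    exact Set.ncard_le_card _

theorem choose_two_le_nu {M : Finset (Fin n →₀ ℕ)} {m : ℕ}
    (hm : (m : ℝ) ≥ (M.card : ℝ) - (Real.sqrt (1 + 8 * (nu M : ℝ)) - 1) / 2) :
    (M.card - m + 1).choose 2 ≤ nu M := by
  rcases le_total M.card m with h | h
  · simp [Nat.sub_eq_zero_of_le h]
  · obtain ⟨k, hk⟩ := Nat.exists_eq_add_of_le h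
    rw [hk, Nat.add_sub_cancel_left]
    rw [hk] at hm
    push_cast at hm
    have h₁ : 2 * (k : ℝ) + 1 ≤ Real.sqrt (1 + 8 * (nu M : ℝ)) := by linarith
    have h₂ : (2 * (k : ℝ) + 1) ^ 2 ≤ 1 + 8 * (nu M : ℝ) :=
      (Real.le_sqrt' (by positivity)).1 h₁
    have h₃ : (2 * k + 1) ^ 2 ≤ 1 + 8 * nu M := by exact_mod_cast h₂
    rw [Nat.choose_two_right, Nat.add_sub_cancel]
    refine Nat.div_le_of_le_mul ?_
    nlinarith

/-- A rewriting rule on the monomials of `M`: each is congruent to zero, or to a monomial of a set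
`W` of normal forms. The differences of monomials and their normal forms number `|M| - |W|`.
The rule is to be used to reduce all products of two monomials of `M` to zero, hence the condition
on the products of two normal forms. -/
structure Reduction (M : Finset (Fin n →₀ ℕ)) (W : Finset (Fin n →₀ ℕ)) where
  /-- The normal form of a monomial; it is `none` for the monomials congruent to zero. -/
  nf : (Fin n →₀ ℕ) → Option (Fin n →₀ ℕ)
  subset : W ⊆ M
  mem_of_nf : ∀ μ w, nf μ = some w → w ∈ W
  nf_self : ∀ w ∈ W, nf w = some w
  reduces : ∀ w ∈ W, ∀ w' ∈ W, ∃ μ ∈ M, ∃ ρ ∈ M, nf μ = none ∧ (μ + ρ = w + w' ∨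
    ∃ u ∈ M, ∃ v ∈ M, nf u = some w ∧ nf v = some w' ∧ u + v = μ + ρ)

/-- With one matching edge at disposal for each of the products of two out of `k` normal forms, all
these products can be reduced to zero. An edge `s(i, j)` between vertices with loops provides the
relation `(X_i²) (X_j²) = (X_i X_j)²`. Those edges that serve the squares provide the normal forms
`X_i X_j`, whose squares vanish because `X_i²` does; the edge that serves the product of two
distinct normal forms `w`, `w'` has `X_i² ≡ w` and `X_j² ≡ w'`, and `X_i X_j` vanishes. The edges
being disjoint, these choices do not interfere. -/
theorem exists_reduction {M : Finset (Fin n →₀ ℕ)} (hM : ∀ μ ∈ M, μ.degree ≤ 2) {k : ℕ}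
    (hk : (k + 1).choose 2 ≤ nu M) : ∃ W, W.card = k ∧ Nonempty (Reduction M W) := by
  classical
  obtain ⟨A, hA, hcard⟩ := exists_isMatching_ncard_eq
    ((supportGraph M).induce (loopVertices M))
  have hle : Fintype.card (Sym2 (Fin k)) ≤ Nat.card A.edgeSet := by
    rw [Sym2.card, Fintype.card_fin, Nat.card_coe_set_eq, hcard]; exact hk
  obtain ⟨ε⟩ : Nonempty (Sym2 (Fin k) ↪ A.edgeSet) := by
    have := Fintype.ofFinite A.edgeSet
    exact Function.Embedding.nonempty_of_card_le (by rwa [Nat.card_eq_fintype_card] at hle)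
  have hends : ∀ s, ∃ i j : loopVertices M, A.Adj i j ∧
      (ε s : Sym2 (loopVertices M)) = s(i, j) := by
    intro s
    obtain ⟨e, he⟩ := ε s
    induction e using Sym2.ind with | _ i j
    exact ⟨i, j, he, rfl⟩
  choose i j hadj hε using hends
  have hij : ∀ s, (i s : Fin (n + 1)) ≠ j s := fun s => (hadj s).adj_sub.1
  have hinj : ∀ s t, s(i s, j s) = s(i t, j t) → s = t := fun s t h =>
    ε.injective (Subtype.ext (by rw [hε, hε, h]))
  have huniq : ∀ {a b c}, A.Adj a b → A.Adj a c → b = c := fun hb hc =>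
    (hA (A.edge_vert hb)).unique hb hc
  have hii : ∀ s t, i s = i t → s = t := fun s t h => by
    have e : j s = j t := huniq (h ▸ hadj s) (hadj t)
    exact hinj s t (by rw [h, e])
  have hjj : ∀ s t, j s = j t → s = t := fun s t h => by
    have e : i s = i t := huniq (h ▸ (hadj s).symm) (hadj t).symm
    exact hinj s t (by rw [h, e])
  have hij' : ∀ s t, i s = j t → s = t := fun s t h => by
    have e : j s = i t := huniq (h ▸ hadj s) (hadj t).symm
    exact hinj s t (by rw [h, e, Sym2.eq_swap])
  let δ : Sym2 (Fin (n + 1)) → Fin n →₀ ℕ := fun e => (edgeSum e).tail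
  have hδ : Function.Injective δ := fun e f h =>
    edgeSum_injective (eq_of_tail_eq (by rw [degree_edgeSum, degree_edgeSum]) h)
  let φ : Sym2 (Fin k) × Fin 3 → Sym2 (Fin (n + 1)) := fun x =>
    ![s((i x.1 : Fin (n + 1)), (i x.1 : Fin (n + 1))),
      s((j x.1 : Fin (n + 1)), (j x.1 : Fin (n + 1))),
      s((i x.1 : Fin (n + 1)), (j x.1 : Fin (n + 1)))] x.2
  have hφ : Function.Injective φ := by
    rintro ⟨s, c⟩ ⟨t, d⟩ h
    have hst : s = t := by
      fin_cases c <;> fin_cases d <;> simp [φ, Subtype.coe_inj] at h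
      · exact hii _ _ h
      · exact hij' _ _ h
      · exact hii _ _ (by tauto)
      · exact (hij' _ _ h.symm).symm
      · exact hjj _ _ h
      · exact hjj _ _ (by tauto)
      · exact hii _ _ (by tauto)
      · exact hjj _ _ (by tauto)
      · rcases h with h | h
        · exact hii _ _ h.1
        · exact hij' _ _ h.1
    subst hst
    have h₁ := hij s
    have h₂ := h₁.symm
    fin_cases c <;> fin_cases d <;> simp [φ, h₁, h₂] at h ⊢
  have hΦ : Function.Injective (δ ∘ φ) := hδ.comp hφ
  have hmem : ∀ x, δ (φ x) ∈ M := by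
    rintro ⟨s, c⟩
    refine (edgeSum_mem_homogenizedSupport hM _).1 ?_
    rw [← mem_edgesAndLoops]
    fin_cases c
    · exact Or.inr ⟨i s, (i s).2, rfl⟩
    · exact Or.inr ⟨j s, (j s).2, rfl⟩
    · exact Or.inl (hadj s).adj_sub
  have hrel : ∀ s, δ (φ (s, 0)) + δ (φ (s, 1)) = δ (φ (s, 2)) + δ (φ (s, 2)) := by
    intro s
    simp only [δ, φ, ← tail_add]
    congr 1
    simp only [Matrix.cons_val_zero, Matrix.cons_val_one, Matrix.cons_val, edgeSum_mk]
    abel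
  let w : Fin k → Fin n →₀ ℕ := fun p => δ (φ (s(p, p), 2))
  have hw : Function.Injective w := fun p q h => by
    simpa using hΦ h
  let target : Sym2 (Fin k) × Fin 3 → Option (Fin n →₀ ℕ) := fun x =>
    if x.1.IsDiag then ![none, none, some (w x.1.inf)] x.2
    else ![some (w x.1.inf), some (w x.1.sup), none] x.2
  let nf : (Fin n →₀ ℕ) → Option (Fin n →₀ ℕ) :=
    Function.extend (δ ∘ φ) target fun _ => none
  have hnf : ∀ x, nf (δ (φ x)) = target x := fun x => hΦ.extend_apply target _ x
  refine ⟨Finset.univ.image w, by rw [Finset.card_image_of_injective _ hw]; simp, ⟨{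
    nf := nf
    subset := fun μ hμ => by
      obtain ⟨p, -, rfl⟩ := Finset.mem_image.1 hμ
      exact hmem _
    mem_of_nf := fun μ v h => by
      by_cases hx : ∃ x, (δ ∘ φ) x = μ
      · obtain ⟨⟨s, c⟩, rfl⟩ := hx
        rw [Function.comp_apply, hnf] at h
        simp only [target] at h
        split_ifs at h <;> fin_cases c <;> simp at h <;> simp [← h]
      · simp only [nf, Function.extend_apply' _ _ _ hx, reduceCtorEq] at h
    nf_self := fun μ hμ => by
      obtain ⟨p, -, rfl⟩ := Finset.mem_image.1 hμ
      rw [hnf]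
      simp [target]
    reduces := fun μ hμ ρ hρ => by
      obtain ⟨p, -, rfl⟩ := Finset.mem_image.1 hμ
      obtain ⟨q, -, rfl⟩ := Finset.mem_image.1 hρ
      by_cases hpq : p = q
      · subst hpq
        exact ⟨_, hmem (s(p, p), 0), _, hmem (s(p, p), 1), by rw [hnf]; simp [target],
          Or.inl (hrel _)⟩
      · refine ⟨_, hmem (s(p, q), 2), _, hmem (s(p, q), 2), by rw [hnf]; simp [target, hpq],
          Or.inr ?_⟩
        rcases lt_or_gt_of_ne hpq with h | h
        · exact ⟨_, hmem (s(p, q), 0), _, hmem (s(p, q), 1),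
            by rw [hnf]; simp [target, hpq, h.le], by rw [hnf]; simp [target, hpq, h.le], hrel _⟩
        · exact ⟨_, hmem (s(p, q), 1), _, hmem (s(p, q), 0),
            by rw [hnf]; simp [target, hpq, h.le], by rw [hnf]; simp [target, hpq, h.le],
            by rw [add_comm, hrel]⟩ }⟩⟩

end Witness

/-! ### The linear system -/

section Macaulay

variable {n m : ℕ} {M : Finset (Fin n →₀ ℕ)} {L : Type u} [Field L]

theorem coeff_monomial_mul_poly (f : Fin m × M → L) (i : Fin m) (μ σ : Fin n →₀ ℕ) :
    MvPolynomial.coeff σ (MvPolynomial.monomial μ 1 * poly f i) =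
      ∑ ν : M, if μ + ν = σ then f (i, ν) else 0 := by
  simp [poly, Finset.mul_sum, MvPolynomial.monomial_mul, MvPolynomial.coeff_sum,
    MvPolynomial.coeff_monomial]

theorem macaulayMatrix_apply (f : Fin m × M → L) (σ : ↥(M + M)) (x : Fin m × M) :
    macaulayMatrix f σ x = ∑ ν : M, if (x.2 : Fin n →₀ ℕ) + ν = σ then f (x.1, ν) else 0 :=
  coeff_monomial_mul_poly _ _ _ _

theorem coeff_sum_poly_mul (f h : Fin m × M → L) (σ : Fin n →₀ ℕ) :
    MvPolynomial.coeff σ (∑ i, poly f i * poly h i) = ∑ x : Fin m × M,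
      MvPolynomial.coeff σ (MvPolynomial.monomial (x.2 : Fin n →₀ ℕ) 1 * poly f x.1) * h x := by
  rw [Fintype.sum_prod_type, MvPolynomial.coeff_sum]
  refine Finset.sum_congr rfl fun i _ => ?_
  have e : poly f i * poly h i =
      ∑ μ : M, MvPolynomial.C (h (i, μ)) *
        (MvPolynomial.monomial (μ : Fin n →₀ ℕ) 1 * poly f i) := by
    rw [mul_comm, poly, Finset.sum_mul]
    refine Finset.sum_congr rfl fun μ _ => ?_
    rw [← mul_assoc, MvPolynomial.C_mul_monomial, mul_one]
  rw [e, MvPolynomial.coeff_sum]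
  exact Finset.sum_congr rfl fun μ _ => by rw [MvPolynomial.coeff_C_mul, mul_comm]

theorem isCertificate_iff (h0 : 0 ∈ M) (f h : Fin m × M → L) :
    IsCertificate f h ↔ (macaulayMatrix f).mulVec h = oneVector M L := by
  rw [IsCertificate, MvPolynomial.ext_iff, funext_iff, Subtype.forall]
  refine forall_congr' fun σ => ?_
  rw [coeff_sum_poly_mul]
  constructor
  · exact fun H _ => H
  · intro H
    by_cases hσ : σ ∈ M + M
    · exact H hσ
    · have h1 : σ ≠ 0 := by
        rintro rfl
        exact hσ (by simpa using Finset.add_mem_add h0 h0)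
      rw [MvPolynomial.coeff_one, if_neg (Ne.symm h1)]
      refine Finset.sum_eq_zero fun x _ => ?_
      rw [coeff_monomial_mul_poly, Finset.sum_eq_zero, zero_mul]
      intro ν _
      rw [if_neg]
      rintro rfl
      exact hσ (Finset.add_mem_add x.2.2 ν.2)

/-- The differences between the monomials of `M` and their normal forms generate `⟨M²⟩`. -/
theorem Reduction.exists_surjective_mulVec {W : Finset (Fin n →₀ ℕ)} (r : Reduction M W)
    (hm : M.card ≤ m + W.card) :
    ∃ f : Fin m × M → L, Function.Surjective (macaulayMatrix f).mulVec := by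
  classical
  have hcard : Fintype.card ↥(M \ W) ≤ Fintype.card (Fin m) := by
    rw [Fintype.card_coe, Fintype.card_fin, Finset.card_sdiff_of_subset r.subset]
    omega
  obtain ⟨ε⟩ := Function.Embedding.nonempty_of_card_le hcard
  let f : Fin m × M → L := fun x => match Function.partialInv ε x.1 with
    | none => 0
    | some μ => (if (x.2 : Fin n →₀ ℕ) = μ then 1 else 0) -
        if r.nf μ = some (x.2 : Fin n →₀ ℕ) then 1 else 0
  have hf : ∀ (μ : ↥(M \ W)) (ν : M), f (ε μ, ν) = (if (ν : Fin n →₀ ℕ) = μ then 1 else 0) -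
      if r.nf μ = some (ν : Fin n →₀ ℕ) then 1 else 0 := fun μ ν => by
    simp [f, Function.partialInv_left ε.injective]
  let R := LinearMap.range (macaulayMatrix f).mulVecLin
  let b : (Fin n →₀ ℕ) → ↥(M + M) → L := fun σ τ => if σ = τ then 1 else 0
  have hcol : ∀ μ (hμ : μ ∈ M \ W), ∀ ρ (_ : ρ ∈ M),
      (b (μ + ρ) - (r.nf μ).elim 0 fun w => b (w + ρ)) ∈ R := by
    intro μ hμ ρ hρ
    refine ⟨Pi.single (ε ⟨μ, hμ⟩, ⟨ρ, hρ⟩) 1, ?_⟩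
    rw [Matrix.mulVecLin_apply, Matrix.mulVec_single_one]
    funext σ
    rw [Matrix.col_apply, macaulayMatrix_apply]
    have hμM := (Finset.mem_sdiff.1 hμ).1
    simp only [hf, Pi.sub_apply]
    have e : ∀ ν : M, (if ρ + (ν : Fin n →₀ ℕ) = σ then
        ((if (ν : Fin n →₀ ℕ) = μ then (1 : L) else 0) -
          if r.nf μ = some (ν : Fin n →₀ ℕ) then 1 else 0) else 0) =
        (if ν = ⟨μ, hμM⟩ then b (μ + ρ) σ else 0) -
          if r.nf μ = some (ν : Fin n →₀ ℕ) then b (ν + ρ) σ else 0 := by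
      intro ν
      simp only [b, Subtype.ext_iff, add_comm ρ]
      grind
    rw [Finset.sum_congr rfl fun ν _ => e ν, Finset.sum_sub_distrib]
    congr 1
    · simp
    · cases hw : r.nf μ with
      | none => simp
      | some w =>
        have hwM : w ∈ M := r.subset (r.mem_of_nf _ _ hw)
        rw [Finset.sum_eq_single ⟨w, hwM⟩]
        · simp
        · intro ν _ hν
          rw [if_neg]
          rintro h
          exact hν (Subtype.ext (Option.some.inj h).symm)
        · simp
  have hnone : ∀ μ ∈ M, ∀ ρ ∈ M, r.nf μ = none → b (μ + ρ) ∈ R := by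
    intro μ hμ ρ hρ h
    have hW : μ ∉ W := fun hW => by simp [r.nf_self μ hW] at h
    simpa [h] using hcol μ (Finset.mem_sdiff.2 ⟨hμ, hW⟩) ρ hρ
  have hsome : ∀ μ ∈ M, ∀ ρ ∈ M, ∀ w, r.nf μ = some w → (b (μ + ρ) ∈ R ↔ b (w + ρ) ∈ R) := by
    intro μ hμ ρ hρ w h
    by_cases hW : μ ∈ W
    · rw [r.nf_self μ hW] at h
      rw [Option.some.inj h]
    · have := hcol μ (Finset.mem_sdiff.2 ⟨hμ, hW⟩) ρ hρ
      rw [h] at this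
      exact ⟨fun h' => by simpa using R.sub_mem h' this, fun h' => by simpa using R.add_mem this h'⟩
  have hsome₂ : ∀ μ ∈ M, ∀ ρ ∈ M, ∀ w w', r.nf μ = some w → r.nf ρ = some w' →
      (b (μ + ρ) ∈ R ↔ b (w + w') ∈ R) := by
    intro μ hμ ρ hρ w w' h h'
    have hwM : w ∈ M := r.subset (r.mem_of_nf _ _ h)
    rw [hsome μ hμ ρ hρ w h, add_comm w ρ, hsome ρ hρ w hwM w' h', add_comm w' w]
  have hall : ∀ μ ∈ M, ∀ ρ ∈ M, b (μ + ρ) ∈ R := by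
    intro μ hμ ρ hρ
    cases h : r.nf μ with
    | none => exact hnone μ hμ ρ hρ h
    | some w =>
      cases h' : r.nf ρ with
      | none => rw [add_comm μ ρ]; exact hnone ρ hρ μ hμ h'
      | some w' =>
        rw [hsome₂ μ hμ ρ hρ w w' h h']
        obtain ⟨μ', hμ', ρ', hρ', h0, e | ⟨u, hu, v, hv, hu', hv', e⟩⟩ :=
          r.reduces w (r.mem_of_nf _ _ h) w' (r.mem_of_nf _ _ h')
        · rw [← e]; exact hnone _ hμ' _ hρ' h0
        · rw [← hsome₂ u hu v hv w w' hu' hv', e]; exact hnone _ hμ' _ hρ' h0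
  refine ⟨f, fun v => ?_⟩
  have hv : v = ∑ τ : ↥(M + M), v τ • b τ := by
    funext σ
    simp [b, Finset.sum_apply]
  have hvR : v ∈ R := by
    rw [hv]
    refine R.sum_mem fun τ _ => R.smul_mem _ ?_
    obtain ⟨μ, hμ, ρ, hρ, e⟩ := Finset.mem_add.1 τ.2
    rw [← e]
    exact hall μ hμ ρ hρ
  obtain ⟨h, hh⟩ := hvR
  exact ⟨h, hh⟩

end Macaulay

/-! ### The algorithm -/

section Algorithm

open Matrix

/-- The block diagonal matrix with blocks `A` and `1`, on an index set `I` of suitable size. -/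
def pad {α ρ I R : Type*} [DecidableEq ρ] [Zero R] [One R] (e : I ≃ α ⊕ ρ) (A : Matrix α α R) :
    Matrix I I R :=
  (fromBlocks A 0 0 1).submatrix e e

section Pad

variable {α ρ I R R' : Type*} [DecidableEq ρ] [CommRing R] [CommRing R'] (e : I ≃ α ⊕ ρ)

theorem pad_mul_pad [Fintype α] [Fintype ρ] [Fintype I] (A B : Matrix α α R) :
    pad e A * pad e B = pad e (A * B) := by
  rw [pad, pad, submatrix_mul_equiv, fromBlocks_multiply]
  simp [pad]

theorem pad_one [DecidableEq α] [DecidableEq I] : pad e (1 : Matrix α α R) = 1 := by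
  rw [pad, fromBlocks_one, submatrix_one_equiv]

theorem map_pad (φ : R →+* R') (A : Matrix α α R) : (pad e A).map φ = pad e (A.map φ) := by
  rw [pad, pad, ← submatrix_map, fromBlocks_map]
  simp

theorem pad_mul_apply_inl [Fintype α] [Fintype ρ] [Fintype I] (A : Matrix α α R)
    (Z : Matrix I I R) (i : α) (j : I) :
    (pad e A * Z) (e.symm (Sum.inl i)) j = ∑ l, A i l * Z (e.symm (Sum.inl l)) j := by
  rw [mul_apply, ← e.symm.sum_comp, Fintype.sum_sum_type]
  simp [pad]

end Pad

/-- A point, over some extension field of `K`, at which the polynomial `P` does not vanish. -/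
structure GenericPoint (K : Type u) [Field K] {ι : Type} (P : MvPolynomial ι K) where
  /-- The field of coordinates. -/
  L : Type u
  [field : Field L]
  [algebra : Algebra K L]
  /-- The coordinates. -/
  a : ι → L
  ne_zero : MvPolynomial.aeval a P ≠ 0

attribute [instance] GenericPoint.field GenericPoint.algebra

/-- A matrix of full row rank has a right inverse supported on as many columns as it has rows. -/
theorem exists_submatrix_mul_eq_one {K : Type u} [Field K] {α β : Type} [Fintype α] [DecidableEq α]
    [Fintype β] {A : Matrix α β K} (hA : Function.Surjective A.mulVec) :
    ∃ s : α → β, Function.Injective s ∧ ∃ G : Matrix α α K, A.submatrix id s * G = 1 := by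
  obtain ⟨κ, a, ha, hspan, hli⟩ := exists_linearIndependent' K A.col
  have htop : Submodule.span K (Set.range (A.col ∘ a)) = ⊤ := by
    rw [hspan, ← range_mulVecLin, LinearMap.range_eq_top]
    exact hA
  let b := Module.Basis.mk hli htop.ge
  let ε : α ≃ κ := (Pi.basisFun K α).indexEquiv b
  refine ⟨a ∘ ε, ha.comp ε.injective, mulVec_surjective_iff_exists_right_inverse.1 ?_⟩
  have h : LinearMap.range (A.submatrix id (a ∘ ε)).mulVecLin = ⊤ := by
    rw [range_mulVecLin, ← htop]
    congr 1
    exact ε.surjective.range_comp (A.col ∘ a)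
  exact LinearMap.range_eq_top.1 h

/-- If the products of one system `f₀` over `K` with `⟨M⟩` span `⟨M²⟩`, then certificates can be
computed generically. The columns of a nonzero maximal minor of the matrix of `f₀` are selected,
and these columns are multiplied, for variable `f`, by the inverse that they have at `f₀`. The
result is the identity matrix at `f₀`, so that its inversion meets only invertible pivots there,
and hence generically. -/
theorem exists_program_of_surjective {K : Type u} [Field K] {ω : ℝ}
    (hω : IsFeasibleExponent K ω) :
    ∃ C : ℝ, 0 ≤ C ∧ ∀ (n m : ℕ) (M : Finset (Fin n →₀ ℕ)) (f₀ : Fin m × M → K), 0 ∈ M →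
      Function.Surjective (macaulayMatrix f₀).mulVec →
      ∃ (p : Program K ((Fin m × M) ⊕ ℕ)) (out : Fin m × M → (Fin m × M) ⊕ ℕ),
        (p.cost : ℝ) ≤ C * ((M + M).card : ℝ) ^ ω ∧
        HoldsGenerically K (Fin m × M) fun _ _ _ f =>
          p.Returns out f fun h => IsCertificate f h := by
  have h2 := two_le_of_isFeasibleExponent hω
  obtain ⟨c₁, hc₁, hmul⟩ := exists_computes_matrix_mul hω
  obtain ⟨c₂, hc₂, hinv⟩ := exists_computes_inverse hω
  refine ⟨(2 * c₁ + c₂) * 2 ^ ω, by positivity, fun n m M f₀ h0 hsurj => ?_⟩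
  obtain ⟨s, hs, G, hG⟩ := exists_submatrix_mul_eq_one hsurj
  set D := (M + M).card with hD
  have hzero : (0 : Fin n →₀ ℕ) ∈ M + M := by simpa using Finset.add_mem_add h0 h0
  have hDpos : 0 < D := Finset.card_pos.2 ⟨0, hzero⟩
  let k := Nat.clog 2 D
  have hDk : D ≤ 2 ^ k := Nat.le_pow_clog (by norm_num) D
  have hkD : 2 ^ k ≤ 2 * D := by
    rcases Nat.lt_or_ge 1 D with h | h
    · have h₁ := Nat.pow_pred_clog_lt_self (b := 2) (by norm_num) h
      have h₂ : 0 < k := Nat.clog_pos (by norm_num) h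
      have h₃ : 2 ^ k = 2 ^ (k - 1) * 2 := by rw [← pow_succ, Nat.sub_add_cancel h₂]
      have h₄ : 2 ^ (k - 1) < D := h₁
      omega
    · have : k = 0 := Nat.clog_of_right_le_one h 2
      rw [this]; omega
  obtain ⟨e⟩ : Nonempty (Idx k ≃ ↥(M + M) ⊕ Fin (2 ^ k - D)) := by
    refine ⟨Fintype.equivOfCardEq ?_⟩
    rw [card_idx, Fintype.card_sum, Fintype.card_coe, Fintype.card_fin]
    omega
  let A : Matrix ↥(M + M) ↥(M + M) (MvPolynomial (Fin m × M) K) := fun σ τ =>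
    ∑ ν : M, if ((s τ).2 : Fin n →₀ ℕ) + ν = σ then MvPolynomial.X ((s τ).1, ν) else 0
  have hA : ∀ {R : Type u} [Field R] (φ : MvPolynomial (Fin m × M) K →+* R) (σ τ : ↥(M + M)),
      φ (A σ τ) = macaulayMatrix (fun x => φ (MvPolynomial.X x)) σ (s τ) := by
    intro R _ φ σ τ
    rw [macaulayMatrix_apply, map_sum]
    exact Finset.sum_congr rfl fun ν _ => by split_ifs <;> simp
  let P := pivotProd k (pad e A * pad e (G.map MvPolynomial.C))
  have hP₀ : MvPolynomial.eval f₀ P = 1 := by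
    have e₁ : A.map (MvPolynomial.eval f₀) = (macaulayMatrix f₀).submatrix id s := by
      ext σ τ
      rw [map_apply, hA]
      simp
    have e₂ : (G.map MvPolynomial.C).map (MvPolynomial.eval f₀) = G := by
      ext σ τ
      simp
    rw [map_pivotProd, Matrix.map_mul, map_pad, map_pad, e₁, e₂, pad_mul_pad, hG, pad_one,
      pivotProd_one]
  -- from here on, all quantities live in the ring of functions on the generic points
  let x : Fin m × M → ∀ θ : GenericPoint K P, θ.L := fun i θ => θ.a i
  let ev : MvPolynomial (Fin m × M) K →ₐ[K] (∀ θ : GenericPoint K P, θ.L) := MvPolynomial.aeval x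
  have hev : ∀ Q θ, ev Q θ = MvPolynomial.aeval θ.a Q := fun Q θ =>
    (MvPolynomial.comp_aeval_apply x (Pi.evalAlgHom K (fun θ : GenericPoint K P => θ.L) θ) Q)
  have hPunit : IsUnit (ev P) := Pi.isUnit_iff.2 fun θ => by
    rw [hev]; exact θ.ne_zero.isUnit
  let A' := pad e (A.map ev)
  let G' := pad e (G.map (algebraMap K (∀ θ : GenericPoint K P, θ.L)))
  have hB : A' * G' = (pad e A * pad e (G.map MvPolynomial.C)).map (ev : _ →+* _) := by
    have e₁ : (G.map (MvPolynomial.C (σ := Fin m × M))).map (ev : _ →+* _) =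
        G.map (algebraMap K (∀ θ : GenericPoint K P, θ.L)) :=
      Matrix.ext fun σ τ => ev.commutes (G σ τ)
    rw [Matrix.map_mul, map_pad, map_pad, e₁]
    rfl
  have hBunit : IsUnit (pivotProd k (A' * G')) := by
    rw [hB, ← map_pivotProd]
    exact hPunit
  let S := Set.range x
  let consts := Set.range (algebraMap K (∀ θ : GenericPoint K P, θ.L))
  have hpad : ∀ {B : Matrix ↥(M + M) ↥(M + M) (∀ θ : GenericPoint K P, θ.L)}
      {T : Set (∀ θ : GenericPoint K P, θ.L)}, entries B ⊆ T → consts ⊆ T →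
      entries (pad e B) ⊆ T := by
    rintro B T hBT hT _ ⟨⟨i, j⟩, rfl⟩
    have hz : (0 : ∀ θ : GenericPoint K P, θ.L) ∈ T := hT ⟨0, map_zero _⟩
    have ho : (1 : ∀ θ : GenericPoint K P, θ.L) ∈ T := hT ⟨1, map_one _⟩
    simp only [pad, submatrix_apply]
    rcases e i with i | i <;> rcases e j with j | j
    · exact hBT (mem_entries B i j)
    · exact hz
    · exact hz
    · rw [fromBlocks_apply₂₂, one_apply]
      split_ifs
      exacts [ho, hz]
  have hAS : entries A' ⊆ S ∪ consts := by
    refine hpad ?_ Set.subset_union_right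
    rintro _ ⟨⟨σ, τ⟩, rfl⟩
    have hA' : A.map ev σ τ =
        ∑ ν : M, if ((s τ).2 : Fin n →₀ ℕ) + ν = σ then x ((s τ).1, ν) else 0 := by
      rw [map_apply, map_sum]
      refine Finset.sum_congr rfl fun ν _ => ?_
      split_ifs
      exacts [MvPolynomial.aeval_X _ _, map_zero _]
    change A.map ev σ τ ∈ S ∪ consts
    rw [hA']
    by_cases h : ∃ ν : M, ((s τ).2 : Fin n →₀ ℕ) + ν = σ
    · obtain ⟨ν, hν⟩ := h
      refine Or.inl ⟨((s τ).1, ν), ?_⟩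
      rw [Finset.sum_eq_single ν]
      · rw [if_pos hν]
      · intro ν' _ hne
        refine if_neg fun h => ?_
        exact hne (Subtype.ext (add_left_cancel (h.trans hν.symm)))
      · simp
    · refine Or.inr ⟨0, ?_⟩
      rw [map_zero, Finset.sum_eq_zero]
      intro ν _
      exact if_neg fun hν => h ⟨ν, hν⟩
  have hGS : entries G' ⊆ S ∪ entries A' ∪ consts := by
    refine hpad ?_ Set.subset_union_right
    rintro _ ⟨⟨σ, τ⟩, rfl⟩
    exact Or.inr ⟨G σ τ, rfl⟩
  obtain ⟨ν, hν, hmul⟩ := hmul (2 ^ k)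
  obtain ⟨μ, hμ, hinv⟩ := hinv k
  have hcard := card_idx k
  obtain ⟨Y, hY, cY⟩ := hinv (S := S ∪ entries A' ∪ entries G' ∪ entries (A' * G')) hBunit
    Set.subset_union_right
  have fin := fun B : Matrix (Idx k) (Idx k) (∀ θ : GenericPoint K P, θ.L) => finite_entries B
  let Z := G' * Y
  have hZ : A' * Z = 1 := by rw [← Matrix.mul_assoc, hY]
  let h : Fin m × M → ∀ θ : GenericPoint K P, θ.L := Function.extend s
    (fun σ => Z (e.symm (Sum.inl σ)) (e.symm (Sum.inl ⟨0, hzero⟩))) 0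
  have comp : Computes K (0 + (0 + (ν + (μ + (ν + 0))))) S (Set.range h) :=
    (Computes.of_subset_union_constants hAS).andThen (fin _) <|
    (Computes.of_subset_union_constants hGS).andThen (fin _) <|
    (hmul (A := A') (B := G') hcard (fun x hx => by simp [hx])
      (fun x hx => by simp [hx])).andThen (fin _) <|
    cY.andThen (fin _) <|
    (hmul (A := G') (B := Y) hcard (fun x hx => by simp [hx])
      (fun x hx => by simp [hx])).andThen (fin _) <|
    Computes.of_subset_union_constants (by
      rintro _ ⟨y, rfl⟩
      by_cases hy : ∃ σ, s σ = y
      · obtain ⟨σ, rfl⟩ := hy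
        refine Or.inl (Or.inr ?_)
        simp only [h, hs.extend_apply]
        exact mem_entries _ _ _
      · refine Or.inr ⟨0, ?_⟩
        simp only [h, Function.extend_apply' _ _ _ hy, map_zero, Pi.zero_apply])
  obtain ⟨p, out, hp, hret⟩ := comp x h le_rfl le_rfl
  refine ⟨p, out, ?_, P, ⟨f₀, by rw [hP₀]; exact one_ne_zero⟩, fun L _ _ f hf => ?_⟩
  · have e₁ : (p.cost : ℝ) ≤ 2 * ν + μ := by
      have : p.cost ≤ 2 * ν + μ := by omega
      exact_mod_cast this
    have e₂ : ((2 ^ k : ℕ) : ℝ) ^ ω ≤ 2 ^ ω * (D : ℝ) ^ ω := by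
      rw [← Real.mul_rpow (by norm_num) (Nat.cast_nonneg _)]
      exact Real.rpow_le_rpow (Nat.cast_nonneg _) (by exact_mod_cast hkD) (by linarith)
    calc (p.cost : ℝ) ≤ (2 * c₁ + c₂) * ((2 ^ k : ℕ) : ℝ) ^ ω := by linarith
      _ ≤ (2 * c₁ + c₂) * (2 ^ ω * (D : ℝ) ^ ω) := by gcongr
      _ = _ := by ring
  · let θ : GenericPoint K P := { L := L, a := f, ne_zero := hf }
    intro mem hmem
    obtain ⟨mem', hrun, hres⟩ := hret θ mem hmem
    refine ⟨mem', hrun, ?_⟩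
    rw [show (fun y => mem' (out y)) = fun y => h y θ from funext hres]
    change IsCertificate f fun y => h y θ
    rw [isCertificate_iff h0]
    funext σ
    have hs' : (macaulayMatrix f).mulVec (fun y => h y θ) σ = ∑ τ : ↥(M + M),
        macaulayMatrix f σ (s τ) * Z (e.symm (Sum.inl τ)) (e.symm (Sum.inl ⟨0, hzero⟩)) θ := by
      refine (Fintype.sum_of_injective s hs _ _ (fun y hy => ?_) fun τ => ?_).symm
      · simp only [h, Function.extend_apply' _ _ _ hy, Pi.zero_apply, mul_zero]
      · simp only [h, hs.extend_apply]
    have hZ' := congrFun (congrFun (congrFun hZ (e.symm (Sum.inl σ)))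
      (e.symm (Sum.inl ⟨0, hzero⟩))) θ
    rw [pad_mul_apply_inl, Finset.sum_apply] at hZ'
    rw [hs']
    refine Eq.trans (Finset.sum_congr rfl fun τ _ => ?_) (hZ'.trans ?_)
    · rw [Pi.mul_apply, map_apply]
      congr 1
      rw [hev]
      refine ((hA (MvPolynomial.aeval f : _ →ₐ[K] L).toRingHom σ τ).trans ?_).symm
      congr 1
      funext y
      exact MvPolynomial.aeval_X f y
    · rw [one_apply, oneVector, MvPolynomial.coeff_one]
      by_cases hσ : σ = ⟨0, hzero⟩
      · subst hσ; simp
      · have hσ' : (0 : Fin n →₀ ℕ) ≠ σ := fun h => hσ (Subtype.ext h.symm)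
        rw [if_neg (by simpa using hσ), if_neg hσ']
        rfl

end Algorithm

end Fewnomial

open Fewnomial
theorem mainTheorem3 {K : Type u} [Field K] (hK : (2 : K) ≠ 0)
    (ω : ℝ) (hω : IsFeasibleExponent K ω) :
    ∃ (C : ℝ) (q : Polynomial ℕ),
      ∀ (n m : ℕ) (M : Finset (Fin n →₀ ℕ)), 0 ∈ M → (∀ μ ∈ M, μ.degree ≤ 2) →
        (m : ℝ) ≥ (M.card : ℝ) - (Real.sqrt (1 + 8 * (nu M : ℝ)) - 1) / 2 →
        -- certificates with support in `M` are the solutions of a linear system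
        (∀ (L : Type u) [Field L] [Algebra K L] (f h : Fin m × M → L),
          IsCertificate f h ↔ (macaulayMatrix f).mulVec h = oneVector M L) ∧
        -- for a generic system, one of them is computed within the stated number of operations
        (∃ (p : Program K ((Fin m × M) ⊕ ℕ)) (out : Fin m × M → (Fin m × M) ⊕ ℕ),
          (p.cost : ℝ) ≤ C * complexityBound m M ω ∧
          HoldsGenerically K (Fin m × M) fun L _ _ f =>
            p.Returns out f fun h => IsCertificate f h) ∧
        -- the number of operations is polynomial in the size `m |M|` of the input
        complexityBound m M ω ≤ ((q.eval (m * M.card) : ℕ) : ℝ) := by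
  have h2 := two_le_of_isFeasibleExponent hω
  obtain ⟨C, hC, hprog⟩ := exists_program_of_surjective hω
  refine ⟨C, Polynomial.X ^ (1 + ⌈ω - 1⌉₊), fun n m M h0 hM hm =>
    ⟨fun L _ _ f h => isCertificate_iff h0 f h, ?_⟩⟩
  obtain ⟨W, hW, ⟨r⟩⟩ := exists_reduction hM (choose_two_le_nu hm)
  obtain ⟨f₀, hf₀⟩ := r.exists_surjective_mulVec (m := m) (L := K) (by omega)
  obtain ⟨p, out, hp, hgen⟩ := hprog n m M f₀ h0 hf₀
  have hpos : 0 < (M + M).card := Finset.card_pos.2 ⟨0 + 0, Finset.add_mem_add h0 h0⟩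
  have hle : (M + M).card ≤ m * M.card := by
    have h := LinearMap.finrank_le_finrank_of_surjective (f := (macaulayMatrix f₀).mulVecLin) hf₀
    simpa using h
  have hbound : complexityBound m M ω =
      ((m * M.card : ℕ) : ℝ) * ((M + M).card : ℝ) ^ (ω - 1) := by
    have h : ((M + M).card : ℝ) + lambdaCount M = (M.card + 1).choose 2 + cliqueCount₄ M := by
      exact_mod_cast card_add_self_add_lambdaCount hM
    rw [complexityBound, ← sub_eq_of_eq_add h.symm]
    push_cast
    ring_nf
  have hpos' : (0 : ℝ) < (M + M).card := by exact_mod_cast hpos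
  have hle' : ((M + M).card : ℝ) ≤ (m * M.card : ℕ) := by exact_mod_cast hle
  have hone : (1 : ℝ) ≤ (m * M.card : ℕ) := by exact_mod_cast hpos.trans_le hle
  refine ⟨⟨p, out, hp.trans ?_, hgen⟩, ?_⟩
  · rw [hbound]
    refine mul_le_mul_of_nonneg_left ?_ hC
    calc ((M + M).card : ℝ) ^ ω = (M + M).card * ((M + M).card : ℝ) ^ (ω - 1) := by
          rw [Real.rpow_sub_one hpos'.ne']; field_simp
      _ ≤ _ := by gcongr
  · rw [hbound, Polynomial.eval_pow, Polynomial.eval_X, Nat.cast_pow, pow_add, pow_one]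
    gcongr
    calc ((M + M).card : ℝ) ^ (ω - 1) ≤ ((m * M.card : ℕ) : ℝ) ^ (ω - 1) :=
          Real.rpow_le_rpow hpos'.le hle' (by linarith)
      _ ≤ ((m * M.card : ℕ) : ℝ) ^ (⌈ω - 1⌉₊ : ℝ) :=
          Real.rpow_le_rpow_of_exponent_le hone (Nat.le_ceil _)
      _ = _ := Real.rpow_natCast _ _
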